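/- **Setting.** Let $\mathcal V$ be a monoidal category (tensor product $\otimes$, unit object $I$, associator $\alpha$, unitors $\lambda,\rho$; no symmetry is assumed) which has all small products and all equalizers and in which every functor $-\otimes s$ has a right adjoint $(-)^s$, so that every $f: r\otimes s\to t$ has a name $\lceil f\rceil: r\to t^s$. Suppose $\mathcal V$ carries an interchange ("relator's involution"), that is, a family of arrows $$m_{\langle p,s\rangle,\langle r,t\rangle}:(p\otimes s)\otimes(r\otimes t)\to(p\otimes r)\otimes(s\otimes t)$$ which is natural in $p,s,r,t$, inverse to itself, $m_{\langle p,r\rangle,\langle s,t\rangle}\circ m_{\langle p,s\rangle,\langle r,t\rangle}=1$, and coherent in the following sense: * (associativity) the two composites $((p\otimes p')\otimes(r\otimes r'))\otimes(t\otimes t')\to(p\otimes(r\otimes t))\otimes(p'\otimes(r'\otimes t'))$, namely $(\alpha\otimes\alpha)\circ m_{\langle p\otimes r,p'\otimes r'\rangle,\langle t,t'\rangle}\circ(m_{\langle p,p'\rangle,\langle r,r'\rangle}\otimes 1)$ and $m_{\langle p,p'\rangle,\langle r\otimes t,r'\otimes t'\rangle}\circ(1\otimes m_{\langle r,r'\rangle,\langle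 t,t'\rangle})\circ\alpha$, are equal; * (units) $\lambda_{r\otimes t}=(\lambda_r\otimes\lambda_t)\circ m_{\langle I,I\rangle,\langle r,t\rangle}\circ(\lambda_I^{-1}\otimes 1)$ and $\rho_{p\otimes s}=(\rho_p\otimes\rho_s)\circ m_{\langle p,s\rangle,\langle I,I\rangle}\circ(1\otimes\lambda_I^{-1})$; * (middle unit) $m_{\langle p,I\rangle,\langle I,t\rangle}=1$. Let $\sigma_{r,s}:r\otimes s\to s\otimes r$ be the exchange $r\otimes s\cong(I\otimes r)\otimes(s\otimes I)\xrightarrow{m}(I\otimes s)\otimes(r\otimes I)\cong s\otimes r$. Let $\mathbf{Cat}_{\mathcal V}$ be the category of $\mathcal V$-enriched categories and $\mathcal V$-functors, and let $T$ be a $\mathcal V$-category with a small set of objects. Composition is written in diagrammatic order, $Y(x;y)\otimes Y(y;z)\to Y(x;z)$, and $1_x: I\to Y(x;x)$ denotes the units. **Constructions.** 1. $X\otimes T$ has the objects $\langle x,s\rangle$, hom-objects $X(x;x')\otimes T(s;s')$, the composition obtained from $m$ and the compositions of $X$ and $T$, and the units $1_x\otimes 1_s$ (precomposed with $I\cong I\otimes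 I$). For a $\mathcal V$-functor $f:X\to X'$, the $\mathcal V$-functor $f\otimes 1_T:X\otimes T\to X'\otimes T$ acts by $f$ on the first factor. 2. $Y^{(T)}$ has as objects the $\mathcal V$-functors $\phi:T\to Y$; its hom-object $Y^{(T)}(\phi;\psi)$ of $\mathcal V$-natural transforms is the equalizer in $\mathcal V$ of the two arrows $$\prod_{s}Y(\phi s;\psi s)\rightrightarrows\prod_{s,t}Y(\phi s;\psi t)^{T(s;t)}$$ whose $(s,t)$-components are the projection to $Y(\phi s;\psi s)$ followed by the name of the precontact arrow $Y(\phi s;\psi s)\otimes T(s;t)\xrightarrow{1\otimes\psi}Y(\phi s;\psi s)\otimes Y(\psi s;\psi t)\to Y(\phi s;\psi t)$, and the projection to $Y(\phi t;\psi t)$ followed by the name of the postcontact arrow $Y(\phi t;\psi t)\otimes T(s;t)\xrightarrow{\sigma}T(s;t)\otimes Y(\phi t;\psi t)\xrightarrow{\phi\otimes1}Y(\phi s;\phi t)\otimes Y(\phi t;\psi t)\to Y(\phi s;\psi t)$. Composition and units are componentwise. For a $\mathcal V$-functor $f:Y\to Y'$, the $\mathcal V$-functor $f^{(T)}:Y^{(T)}\to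 Y'^{(T)}$ sends $\phi$ to $\phi$ followed by $f$ and applies $f$ to components. 3. The sections functor $\lambda_X:X\to(X\otimes T)^{(T)}$ sends $a$ to the $\mathcal V$-functor $s\mapsto\langle a,s\rangle$ given on hom-objects by $T(s;t)\cong I\otimes T(s;t)\xrightarrow{1_a\otimes1}X(a;a)\otimes T(s;t)$; on hom-objects its components are $X(a;b)\cong X(a;b)\otimes I\xrightarrow{1\otimes1_s}X(a;b)\otimes T(s;s)$. 4. The evaluation functor $\mathrm{ev}_Y:Y^{(T)}\otimes T\to Y$ sends $\langle\phi,s\rangle$ to $\phi(s)$ and is given on hom-objects by the $s$-component followed by the precontact arrow. 5. The name of $f:X\otimes T\to Y$ is $f^\#:X\xrightarrow{\lambda_X}(X\otimes T)^{(T)}\xrightarrow{f^{(T)}}Y^{(T)}$, and the realization of $g:X\to Y^{(T)}$ is $g^\flat:X\otimes T\xrightarrow{g\otimes1_T}Y^{(T)}\otimes T\xrightarrow{\mathrm{ev}_Y}Y$. An *original $\mathcal V$-graph* consists of vertices, edge objects in $\mathcal V$ and chosen unit arrows; its *transports* are the maps of vertices and edge objects that preserve the unit arrows. For original $\mathcal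 V$-graphs, $X\otimes T$ is defined as above (without composition), $Y^T$ has as vertices the transports $T\to Y$ and as edge objects all transforms $\prod_sY(\phi s;\psi s)$, with units $\prod_s 1_{\phi s}$; for a transport $f$, the transports $f\otimes 1_T$ and $f^T$ act by $f$ on the first factor and on components, respectively, and sections $\lambda_X:X\to(X\otimes T)^T$ are given by the formulas in 3. **Proposition.** The constructions above are well defined; $-\otimes T$ and $(-)^{(T)}$ are functors $\mathbf{Cat}_{\mathcal V}\to\mathbf{Cat}_{\mathcal V}$, and: * $-\otimes T$ is left adjoint to $(-)^{(T)}$, by an adjunction whose unit is $(\lambda_X)_X$, whose counit is $(\mathrm{ev}_Y)_Y$, and whose bijection $\mathbf{Cat}_{\mathcal V}(X\otimes T,Y)\cong\mathbf{Cat}_{\mathcal V}(X,Y^{(T)})$ is $f\mapsto f^\#$ with inverse $g\mapsto g^\flat$. In particular $\lambda$ and $\mathrm{ev}$ are natural for all $\mathcal V$-functors. * Name and realization are inverse to one another, $(f^\#)^\flat=f$ and $(g^\flat)^\#=g$, and both are natural in $X$ and $Y$. * The triangular equalities hold: $\lambda_X\otimes1_T$ followed by $\mathrm{ev}_{X\otimes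 T}$ is the identity of $X\otimes T$, and $\lambda_{Y^{(T)}}$ followed by $(\mathrm{ev}_Y)^{(T)}$ is the identity of $Y^{(T)}$. * Sections are natural even for arbitrary transports $f:X\to Y$ of original $\mathcal V$-graphs: $\lambda_X$ followed by $(f\otimes1_T)^T$ equals $f$ followed by $\lambda_Y$. For a $\mathcal V$-category $X$, the sections functor followed by the inclusion $(X\otimes T)^{(T)}\to(X\otimes T)^T$ is the sections transport of the underlying original $\mathcal V$-graphs; and for a $\mathcal V$-functor $g:Y\to Y'$ the change of target $g^T$ restricts along the inclusions $Y^{(T)}\to Y^T$, $Y'^{(T)}\to Y'^T$ to $g^{(T)}$. -/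

import Mathlib

open CategoryTheory MonoidalCategory Limits
universe c w v u

/-- An interchange (relator's involution) on a monoidal category: a natural, self-inverse family
of arrows `(p ⊗ s) ⊗ (r ⊗ t) ⟶ (p ⊗ r) ⊗ (s ⊗ t)` which is coherent with the associativity and
unit isomorphisms. No symmetry or braiding of `V` is assumed. -/
structure RelatorInvolution (V : Type u) [Category.{v} V] [MonoidalCategory V] where
  /-- the interchange arrows -/
  hom (p s r t : V) : (p ⊗ s) ⊗ (r ⊗ t) ⟶ (p ⊗ r) ⊗ (s ⊗ t)
  /-- the arrows form a natural transformation in all four variables -/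
  naturality {p p' s s' r r' t t' : V} (a : p ⟶ p') (b : s ⟶ s') (c : r ⟶ r') (d : t ⟶ t') :
    ((a ⊗ₘ b) ⊗ₘ (c ⊗ₘ d)) ≫ hom p' s' r' t' = hom p s r t ≫ ((a ⊗ₘ c) ⊗ₘ (b ⊗ₘ d))
  /-- the arrows are inverse to themselves -/
  involution (p s r t : V) : hom p s r t ≫ hom p r s t = 𝟙 _
  /-- coherence with the associator (associativity of composition, componentwise) -/
  associativity (p p' r r' t t' : V) :
    hom p p' r r' ▷ (t ⊗ t') ≫ hom (p ⊗ r) (p' ⊗ r') t t' ≫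
        ((α_ p r t).hom ⊗ₘ (α_ p' r' t').hom) =
      (α_ (p ⊗ p') (r ⊗ r') (t ⊗ t')).hom ≫ (p ⊗ p') ◁ hom r r' t t' ≫
        hom p p' (r ⊗ t) (r' ⊗ t')
  /-- coherence with the left unitor -/
  left_unitality (r t : V) :
    (λ_ (r ⊗ t)).hom =
      (λ_ (𝟙_ V)).inv ▷ (r ⊗ t) ≫ hom (𝟙_ V) (𝟙_ V) r t ≫ ((λ_ r).hom ⊗ₘ (λ_ t).hom)
  /-- coherence with the right unitor -/
  right_unitality (p s : V) :
    (ρ_ (p ⊗ s)).hom =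
      (p ⊗ s) ◁ (λ_ (𝟙_ V)).inv ≫ hom p s (𝟙_ V) (𝟙_ V) ≫ ((ρ_ p).hom ⊗ₘ (ρ_ s).hom)
  /-- interchanging two copies of the unit object changes nothing -/
  middle_unitality (p t : V) : hom p (𝟙_ V) (𝟙_ V) t = 𝟙 _

namespace RelatorInvolution
variable {V : Type u} [Category.{v} V] [MonoidalCategory V] (m : RelatorInvolution V)

/-- The exchange of two factors `r ⊗ s ⟶ s ⊗ r` obtained from the interchange
`(I ⊗ r) ⊗ (s ⊗ I) ⟶ (I ⊗ s) ⊗ (r ⊗ I)`. -/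
def swap (r s : V) : r ⊗ s ⟶ s ⊗ r :=
  ((λ_ r).inv ⊗ₘ (ρ_ s).inv) ≫ m.hom (𝟙_ V) r s (𝟙_ V) ≫ ((λ_ s).hom ⊗ₘ (ρ_ r).hom)

theorem swap_swap (r s : V) : m.swap r s ≫ m.swap s r = 𝟙 _ := by
  simp [swap, tensorHom_comp_tensorHom_assoc, reassoc_of% (m.involution (𝟙_ V) r s (𝟙_ V))]

instance (r s : V) : IsIso (m.swap r s) := ⟨m.swap s r, m.swap_swap _ _, m.swap_swap _ _⟩

theorem swap_naturality {r r' s s' : V} (f : r ⟶ r') (g : s ⟶ s') :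
    (f ⊗ₘ g) ≫ m.swap r' s' = m.swap r s ≫ (g ⊗ₘ f) := by
  have h := m.naturality (𝟙 (𝟙_ V)) f g (𝟙 (𝟙_ V))
  simp only [swap, Category.assoc, tensorHom_comp_tensorHom_assoc]
  have e1 : f ≫ (λ_ r').inv = (λ_ r).inv ≫ (𝟙 _ ⊗ₘ f) := by simp
  have e2 : g ≫ (ρ_ s').inv = (ρ_ s).inv ≫ (g ⊗ₘ 𝟙 _) := by simp
  rw [e1, e2, ← tensorHom_comp_tensorHom_assoc, reassoc_of% h]
  simp [tensorHom_comp_tensorHom]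

theorem hom_I_I_x_x (r t : V) : m.hom (𝟙_ V) (𝟙_ V) r t =
    (λ_ (𝟙_ V)).hom ▷ (r ⊗ t) ≫ (λ_ (r ⊗ t)).hom ≫ ((λ_ r).inv ⊗ₘ (λ_ t).inv) := by
  rw [m.left_unitality]; simp [tensorHom_comp_tensorHom]

theorem hom_x_x_I_I (p s : V) : m.hom p s (𝟙_ V) (𝟙_ V) =
    (p ⊗ s) ◁ (λ_ (𝟙_ V)).hom ≫ (ρ_ (p ⊗ s)).hom ≫ ((ρ_ p).inv ⊗ₘ (ρ_ s).inv) := by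
  rw [m.right_unitality]; simp [tensorHom_comp_tensorHom, ← MonoidalCategory.whiskerLeft_comp_assoc]

theorem hom_I_x_I_x (s t : V) : m.hom (𝟙_ V) s (𝟙_ V) t =
    ((λ_ s).hom ⊗ₘ (λ_ t).hom) ≫ (λ_ (s ⊗ t)).inv ≫ (λ_ (𝟙_ V)).inv ▷ (s ⊗ t) := by
  have h := m.involution (𝟙_ V) s (𝟙_ V) t
  rw [hom_I_I_x_x] at h
  have := congrArg (· ≫ ((λ_ s).hom ⊗ₘ (λ_ t).hom) ≫ (λ_ (s ⊗ t)).inv ≫ (λ_ (𝟙_ V)).inv ▷ (s ⊗ t)) h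
  simpa [tensorHom_comp_tensorHom, tensorHom_comp_tensorHom_assoc, ← comp_whiskerRight] using this

theorem hom_x_I_x_I (p r : V) : m.hom p (𝟙_ V) r (𝟙_ V) =
    ((ρ_ p).hom ⊗ₘ (ρ_ r).hom) ≫ (ρ_ (p ⊗ r)).inv ≫ (p ⊗ r) ◁ (λ_ (𝟙_ V)).inv := by
  have h := m.involution p (𝟙_ V) r (𝟙_ V)
  rw [hom_x_x_I_I] at h
  have := congrArg (· ≫ ((ρ_ p).hom ⊗ₘ (ρ_ r).hom) ≫ (ρ_ (p ⊗ r)).inv ≫ (p ⊗ r) ◁ (λ_ (𝟙_ V)).inv) h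
  simpa [tensorHom_comp_tensorHom, tensorHom_comp_tensorHom_assoc, ← MonoidalCategory.whiskerLeft_comp] using this


theorem hom_conj {p p' s s' r r' t t' : V} (a : p ≅ p') (b : s ≅ s') (c : r ≅ r') (d : t ≅ t') :
    m.hom p s r t = ((a.hom ⊗ₘ b.hom) ⊗ₘ (c.hom ⊗ₘ d.hom)) ≫ m.hom p' s' r' t' ≫
      ((a.inv ⊗ₘ c.inv) ⊗ₘ (b.inv ⊗ₘ d.inv)) := by
  rw [reassoc_of% (m.naturality a.hom b.hom c.hom d.hom)]
  simp [tensorHom_comp_tensorHom]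

theorem hom_assoc (p p' r r' t t' : V) :
    m.hom (p ⊗ r) (p' ⊗ r') t t' = m.hom p r p' r' ▷ (t ⊗ t') ≫
      (α_ (p ⊗ p') (r ⊗ r') (t ⊗ t')).hom ≫ (p ⊗ p') ◁ m.hom r r' t t' ≫
        m.hom p p' (r ⊗ t) (r' ⊗ t') ≫ ((α_ p r t).inv ⊗ₘ (α_ p' r' t').inv) := by
  have A := m.associativity p p' r r' t t'
  rw [← reassoc_of% A, ← comp_whiskerRight_assoc, m.involution]
  simp [tensorHom_comp_tensorHom]

theorem hom_assoc_right (p p' r r' t t' : V) :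
    m.hom p p' (r ⊗ t) (r' ⊗ t') =
      (p ⊗ p') ◁ m.hom r t r' t' ≫ (α_ (p ⊗ p') (r ⊗ r') (t ⊗ t')).inv ≫
       m.hom p p' r r' ▷ (t ⊗ t') ≫ m.hom (p ⊗ r) (p' ⊗ r') t t' ≫
        ((α_ p r t).hom ⊗ₘ (α_ p' r' t').hom) := by
  have A := m.associativity p p' r r' t t'
  rw [A, Iso.inv_hom_id_assoc, ← MonoidalCategory.whiskerLeft_comp_assoc, m.involution]
  simp

theorem hom_x_x_I_x (r s t : V) : m.hom r s (𝟙_ V) t =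
    (α_ r s (𝟙_ V ⊗ t)).hom ≫ r ◁ s ◁ (λ_ t).hom ≫ (ρ_ r).inv ▷ (s ⊗ t) := by
  rw [m.hom_conj (ρ_ r).symm (λ_ s).symm (Iso.refl _) (Iso.refl _), hom_assoc,
    m.hom_conj (Iso.refl r) (Iso.refl _) (λ_ (𝟙_ V)) (Iso.refl _)]
  simp only [m.middle_unitality, hom_I_x_I_x]
  simp only [Iso.refl_hom, Iso.refl_inv, Iso.symm_hom, Iso.symm_inv]
  monoidal

theorem hom_x_I_x_x (p r t : V) : m.hom p (𝟙_ V) r t =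
    (ρ_ p).hom ▷ (r ⊗ t) ≫ (α_ p r t).inv ≫ (p ⊗ r) ◁ (λ_ t).inv := by
  rw [m.hom_conj (Iso.refl p) (Iso.refl _) (ρ_ r).symm (λ_ t).symm, hom_assoc_right,
    m.hom_conj (Iso.refl (p ⊗ r)) (λ_ (𝟙_ V)) (Iso.refl _)  (Iso.refl _)]
  simp only [m.middle_unitality, hom_x_I_x_I]
  simp only [Iso.refl_hom, Iso.refl_inv, Iso.symm_hom, Iso.symm_inv]
  monoidal

theorem hom_I_x_x_I (r s : V) : m.hom (𝟙_ V) r s (𝟙_ V) =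
    ((λ_ r).hom ⊗ₘ (ρ_ s).hom) ≫ m.swap r s ≫ ((λ_ s).inv ⊗ₘ (ρ_ r).inv) := by
  simp [swap, tensorHom_comp_tensorHom, tensorHom_comp_tensorHom_assoc]

theorem hom_I_x_x_x (s r t : V) : m.hom (𝟙_ V) s r t =
    (λ_ s).hom ▷ (r ⊗ t) ≫ (α_ s r t).inv ≫ m.swap s r ▷ t ≫ (α_ r s t).hom ≫
      (λ_ r).inv ▷ (s ⊗ t) := by
  rw [m.hom_conj (Iso.refl _) (Iso.refl s) (ρ_ r).symm (λ_ t).symm, hom_assoc_right,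
    m.hom_conj (λ_ r) (ρ_ s) (Iso.refl _)  (Iso.refl _)]
  simp only [m.middle_unitality, hom_I_x_x_I, hom_x_x_I_x]
  simp only [Iso.refl_hom, Iso.refl_inv, Iso.symm_hom, Iso.symm_inv]
  monoidal

theorem hom_eq (p s r t : V) : m.hom p s r t =
    (α_ p s (r ⊗ t)).hom ≫ p ◁ (α_ s r t).inv ≫ p ◁ m.swap s r ▷ t ≫
      p ◁ (α_ r s t).hom ≫ (α_ p r (s ⊗ t)).inv := by
  rw [m.hom_conj (ρ_ p).symm (λ_ s).symm (Iso.refl _) (Iso.refl _), hom_assoc,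
    m.hom_conj (Iso.refl p) (Iso.refl _) (λ_ r) (Iso.refl _)]
  simp only [m.middle_unitality, hom_I_x_x_x, hom_x_I_x_x]
  simp only [Iso.refl_hom, Iso.refl_inv, Iso.symm_hom, Iso.symm_inv]
  monoidal

theorem hexagon (x y z : V) :
    (α_ x y z).hom ≫ m.swap x (y ⊗ z) ≫ (α_ y z x).hom =
      m.swap x y ▷ z ≫ (α_ y x z).hom ≫ y ◁ m.swap x z := by
  have A := m.hom_assoc_right (𝟙_ V) x y (𝟙_ V) z (𝟙_ V)
  rw [m.hom_conj (Iso.refl _) (Iso.refl _) (Iso.refl _) (λ_ (𝟙_ V)), hom_I_x_x_I, hom_x_x_I_I,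
    hom_I_x_x_I, m.hom_conj (λ_ y) (ρ_ x) (Iso.refl _) (Iso.refl _), hom_eq] at A
  simp only [Iso.refl_hom, Iso.refl_inv] at A
  have B : m.swap x (y ⊗ z) = (α_ x y z).inv ≫ m.swap x y ▷ z ≫ (α_ y x z).hom ≫
      y ◁ m.swap x z ≫ (α_ y z x).inv := by
    have := congrArg (fun f => (⊗𝟙 : x ⊗ (y ⊗ z) ≅ (𝟙_ V ⊗ x) ⊗ (y ⊗ z) ⊗ 𝟙_ V ⊗ 𝟙_ V).hom ≫ f ≫ (⊗𝟙 : ((𝟙_ V) ⊗ (y ⊗ z)) ⊗ (x ⊗ (𝟙_ V ⊗ 𝟙_ V)) ≅ (y ⊗ z) ⊗ x).hom) A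
    refine Eq.trans ?_ (this.trans ?_)
    · monoidal
    · monoidal
  rw [B]; simp


theorem swap_tensor_left (x y z : V) :
    m.swap (x ⊗ y) z = (α_ x y z).hom ≫ x ◁ m.swap y z ≫ (α_ x z y).inv ≫
        m.swap x z ▷ y ≫ (α_ z x y).hom := by
  have h := m.hexagon z x y
  rw [← cancel_epi (m.swap z (x ⊗ y)), ← cancel_epi (α_ z x y).hom, m.swap_swap,
    reassoc_of% h, ← MonoidalCategory.whiskerLeft_comp_assoc, m.swap_swap,
    MonoidalCategory.whiskerLeft_id, Category.id_comp, Iso.hom_inv_id_assoc,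
    ← comp_whiskerRight_assoc, m.swap_swap]
  simp

theorem swap_unit_left (x : V) : m.swap (𝟙_ V) x = (λ_ x).hom ≫ (ρ_ x).inv := by
  rw [swap, hom_I_I_x_x]; monoidal

theorem naturality_left {p p' s s' : V} (a : p ⟶ p') (b : s ⟶ s') (r t : V) :
    (a ⊗ₘ b) ▷ (r ⊗ t) ≫ m.hom p' s' r t = m.hom p s r t ≫ (a ▷ r ⊗ₘ b ▷ t) := by
  simpa using m.naturality a b (𝟙 r) (𝟙 t)

theorem naturality_right (p s : V) {r r' t t' : V} (c : r ⟶ r') (d : t ⟶ t') :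
    (p ⊗ s) ◁ (c ⊗ₘ d) ≫ m.hom p s r' t' = m.hom p s r t ≫ (p ◁ c ⊗ₘ s ◁ d) := by
  simpa using m.naturality (𝟙 p) (𝟙 s) c d

end RelatorInvolution

/-- A `V`-enriched category, bundled; its objects form a type in `Type w`. -/
structure VCat (V : Type u) [Category.{v} V] [MonoidalCategory V] where
  /-- the type of objects -/
  carrier : Type w
  /-- the enriched category structure -/
  [str : EnrichedCategory V carrier]

namespace VCat
variable {V : Type u} [Category.{v} V] [MonoidalCategory V]

instance : CoeSort (VCat.{w} V) (Type w) := ⟨VCat.carrier⟩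
instance (X : VCat.{w} V) : EnrichedCategory V X := X.str

/-- The category of `V`-enriched categories and `V`-functors (natural functors). -/
instance : Category (VCat.{w} V) where
  Hom X Y := EnrichedFunctor V X Y
  id X := EnrichedFunctor.id V X
  comp f g := EnrichedFunctor.comp V f g
  id_comp f := EnrichedFunctor.ext V (fun _ => rfl)
    (fun _ _ => by simp [EnrichedFunctor.comp, EnrichedFunctor.id])
  comp_id f := EnrichedFunctor.ext V (fun _ => rfl)
    (fun _ _ => by simp [EnrichedFunctor.comp, EnrichedFunctor.id])
  assoc f g h := EnrichedFunctor.ext V (fun _ => rfl)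
    (fun _ _ => by simp [EnrichedFunctor.comp])

end VCat


section tensor
universe x t x'
variable {V : Type u} [Category.{v} V] [MonoidalCategory V] (m : RelatorInvolution V)

/-- The objects of the biproduct `X ⊗ T`: pairs of an object of `X` and an object of `T`. -/
def Biproduct (_ : RelatorInvolution V) (X : Type x) (T : Type t) : Type (max x t) := X × T

namespace Biproduct
variable (X : Type x) [EnrichedCategory V X] (T : Type t) [EnrichedCategory V T]
  {X' : Type x'} [EnrichedCategory V X']

/-- The biproduct `X ⊗ T` of `V`-categories: hom-objects are tensor products of hom-objects,
composition goes through the interchange, units are tensor products of units. -/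
instance : EnrichedCategory V (Biproduct m X T) where
  Hom a b := EnrichedCategory.Hom a.1 b.1 ⊗ EnrichedCategory.Hom a.2 b.2
  id a := (λ_ (𝟙_ V)).inv ≫ (eId V a.1 ⊗ₘ eId V a.2)
  comp a b c := m.hom _ _ _ _ ≫ (eComp V a.1 b.1 c.1 ⊗ₘ eComp V a.2 b.2 c.2)
  id_comp a b := by
    rw [comp_whiskerRight, Category.assoc, reassoc_of% (m.naturality_left (eId V a.1) (eId V a.2)),
      m.hom_I_I_x_x]
    simp [tensorHom_comp_tensorHom]
  comp_id a b := by
    rw [MonoidalCategory.whiskerLeft_comp, Category.assoc, reassoc_of% (m.naturality_right _ _ (eId V b.1) (eId V b.2)),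
      m.hom_x_x_I_I]
    simp [tensorHom_comp_tensorHom, ← MonoidalCategory.whiskerLeft_comp_assoc]
  assoc a b c d := by
    have A := m.associativity (a.1 ⟶[V] b.1) (a.2 ⟶[V] b.2) (b.1 ⟶[V] c.1) (b.2 ⟶[V] c.2)
      (c.1 ⟶[V] d.1) (c.2 ⟶[V] d.2)
    rw [Iso.inv_comp_eq, comp_whiskerRight, MonoidalCategory.whiskerLeft_comp, Category.assoc,
      Category.assoc, reassoc_of% m.naturality_left, reassoc_of% m.naturality_right,
      ← reassoc_of% A]
    simp only [tensorHom_comp_tensorHom, e_assoc']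

variable {X} in
/-- The `V`-functor `g ⊗ 1_T : X ⊗ T ⟶ X' ⊗ T`. -/
def map (g : EnrichedFunctor V X X') :
    EnrichedFunctor V (Biproduct m X T) (Biproduct m X' T) where
  obj a := ⟨g.obj a.1, a.2⟩
  map a b := g.map a.1 b.1 ▷ (a.2 ⟶[V] b.2)
  map_id a := by
    change ((λ_ (𝟙_ V)).inv ≫ (eId V a.1 ⊗ₘ eId V a.2)) ≫ _ = (λ_ (𝟙_ V)).inv ≫ (eId V (g.obj a.1) ⊗ₘ eId V a.2)
    simp [← tensorHom_id, tensorHom_comp_tensorHom]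
  map_comp a b c := by
    change (m.hom _ _ _ _ ≫ (eComp V a.1 b.1 c.1 ⊗ₘ eComp V a.2 b.2 c.2)) ≫ _ = _ ≫ m.hom _ _ _ _ ≫ (eComp V _ _ _ ⊗ₘ eComp V a.2 b.2 c.2)
    simp only [← tensorHom_id]
    rw [reassoc_of% m.naturality, Category.assoc, tensorHom_comp_tensorHom,
      tensorHom_comp_tensorHom, g.map_comp]
    simp
end Biproduct
end tensor

section exp
universe y t y'
variable {V : Type u} [Category.{v} V] [MonoidalCategory V]

/-- The exponential object `t ^ s` of `V`, the value of the right adjoint of `- ⊗ s` at `t`. -/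
noncomputable def expObj (t s : V) [(tensorRight s).IsLeftAdjoint] : V :=
  (tensorRight s).rightAdjoint.obj t

/-- The bijection `V(r ⊗ s, t) ≃ V(r, t ^ s)` taking an arrow to its name. -/
noncomputable def nameEquiv (r s t : V) [(tensorRight s).IsLeftAdjoint] :
    (r ⊗ s ⟶ t) ≃ (r ⟶ expObj t s) :=
  (Adjunction.ofIsLeftAdjoint (tensorRight s)).homEquiv r t

theorem comp_nameEquiv {r r' : V} (s t : V) [(tensorRight s).IsLeftAdjoint] (a : r' ⟶ r) (f : r ⊗ s ⟶ t) :
    a ≫ nameEquiv r s t f = nameEquiv r' s t (a ▷ s ≫ f) :=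
  ((Adjunction.ofIsLeftAdjoint (tensorRight s)).homEquiv_naturality_left a f).symm

variable (m : RelatorInvolution V)
  {T : Type t} [EnrichedCategory V T] {Y : Type y} [EnrichedCategory V Y]
  {Y' : Type y'} [EnrichedCategory V Y']

/-- The precontact arrow, `(α, u) ↦ α_s` followed by `ψ u`. -/
def precontact (φ ψ : EnrichedFunctor V T Y) (s t : T) :
    (φ.obj s ⟶[V] ψ.obj s) ⊗ (s ⟶[V] t) ⟶ (φ.obj s ⟶[V] ψ.obj t) :=
  _ ◁ ψ.map s t ≫ eComp V _ _ _

/-- The postcontact arrow, `(α, u) ↦ φ u` followed by `α_t`. -/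
def postcontact (φ ψ : EnrichedFunctor V T Y) (s t : T) :
    (φ.obj t ⟶[V] ψ.obj t) ⊗ (s ⟶[V] t) ⟶ (φ.obj s ⟶[V] ψ.obj t) :=
  m.swap _ _ ≫ φ.map s t ▷ _ ≫ eComp V _ _ _

theorem comp_precontact (φ ψ χ : EnrichedFunctor V T Y) (s t : T) :
    eComp V (φ.obj s) (ψ.obj s) (χ.obj s) ▷ (s ⟶[V] t) ≫ precontact φ χ s t =
      (α_ _ _ _).hom ≫ _ ◁ precontact ψ χ s t ≫ eComp V _ _ _ := by
  simp only [precontact, MonoidalCategory.whiskerLeft_comp, Category.assoc]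
  rw [← whisker_exchange_assoc, ← e_assoc']; simp

theorem comp_postcontact (φ ψ χ : EnrichedFunctor V T Y) (s t : T) :
    eComp V (φ.obj t) (ψ.obj t) (χ.obj t) ▷ (s ⟶[V] t) ≫ postcontact m φ χ s t =
      (α_ _ _ _).hom ≫ _ ◁ m.swap _ _ ≫ (α_ _ _ _).inv ≫ postcontact m φ ψ s t ▷ _ ≫ eComp V _ _ _ := by
  have n := m.swap_naturality (eComp V (φ.obj t) (ψ.obj t) (χ.obj t)) (𝟙 (s ⟶[V] t))
  simp only [tensorHom_id, id_tensorHom] at n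
  simp only [postcontact, comp_whiskerRight, Category.assoc]
  rw [reassoc_of% n, m.swap_tensor_left, ← e_assoc', whisker_exchange_assoc]; simp

theorem whisker_postcontact (φ ψ χ : EnrichedFunctor V T Y) (s t : T) :
    (φ.obj s ⟶[V] ψ.obj s) ◁ postcontact m ψ χ s t ≫ eComp V _ _ _ =
     _ ◁ m.swap _ _ ≫ (α_ _ _ _).inv ≫ precontact φ ψ s t ▷ _ ≫ eComp V _ _ _ := by
  simp only [postcontact, precontact, comp_whiskerRight, Category.assoc, MonoidalCategory.whiskerLeft_comp]
  rw [← e_assoc']; simp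

theorem comp_precontact_target (f : EnrichedFunctor V Y Y') (φ ψ : EnrichedFunctor V T Y) (s t : T) :
    f.map _ _ ▷ (s ⟶[V] t) ≫ precontact (φ.comp V f) (ψ.comp V f) s t =
      precontact φ ψ s t ≫ f.map _ _ := by
  change _ ≫ _ ◁ (ψ.map s t ≫ f.map _ _) ≫
    eComp V (f.obj (φ.obj s)) (f.obj (ψ.obj s)) (f.obj (ψ.obj t)) = (_ ◁ _ ≫ _) ≫ _
  simp only [MonoidalCategory.whiskerLeft_comp, Category.assoc, EnrichedFunctor.map_comp,
    MonoidalCategory.tensorHom_def, whisker_exchange_assoc]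

theorem comp_postcontact_target (f : EnrichedFunctor V Y Y') (φ ψ : EnrichedFunctor V T Y) (s t : T) :
    f.map _ _ ▷ (s ⟶[V] t) ≫ postcontact m (φ.comp V f) (ψ.comp V f) s t =
      postcontact m φ ψ s t ≫ f.map _ _ := by
  have n := m.swap_naturality (f.map (φ.obj t) (ψ.obj t)) (𝟙 (s ⟶[V] t))
  simp only [tensorHom_id, id_tensorHom] at n
  change _ ≫ m.swap (f.obj (φ.obj t) ⟶[V] f.obj (ψ.obj t)) _ ≫ (φ.map s t ≫ f.map _ _) ▷ _ ≫
    eComp V (f.obj (φ.obj s)) (f.obj (φ.obj t)) (f.obj (ψ.obj t)) = (_ ≫ _ ▷ _ ≫ _) ≫ _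
  rw [reassoc_of% n]
  simp only [comp_whiskerRight, Category.assoc, EnrichedFunctor.map_comp,
    MonoidalCategory.tensorHom_def', whisker_exchange_assoc]

variable [HasProducts.{t} V] [HasEqualizers V] [∀ s : V, (tensorRight s).IsLeftAdjoint]

/-- The arrow into `∏ Y(φ s, ψ t) ^ T(s, t)` whose components are the names of the precontact
arrows. -/
noncomputable def precontactMap (φ ψ : EnrichedFunctor V T Y) :
    (∏ᶜ fun s : T => (φ.obj s ⟶[V] ψ.obj s)) ⟶
      ∏ᶜ fun p : T × T => expObj (φ.obj p.1 ⟶[V] ψ.obj p.2) (p.1 ⟶[V] p.2) :=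
  Pi.lift fun p => Pi.π _ p.1 ≫ nameEquiv _ _ _ (precontact φ ψ p.1 p.2)

/-- The arrow into `∏ Y(φ s, ψ t) ^ T(s, t)` whose components are the names of the postcontact
arrows. -/
noncomputable def postcontactMap (φ ψ : EnrichedFunctor V T Y) :
    (∏ᶜ fun s : T => (φ.obj s ⟶[V] ψ.obj s)) ⟶
      ∏ᶜ fun p : T × T => expObj (φ.obj p.1 ⟶[V] ψ.obj p.2) (p.1 ⟶[V] p.2) :=
  Pi.lift fun p => Pi.π _ p.2 ≫ nameEquiv _ _ _ (postcontact m φ ψ p.1 p.2)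

/-- The object of `V`-natural transforms between `V`-functors `φ, ψ : T ⟶ Y`: the equalizer in `V`
of the precontact and the postcontact arrows out of `∏ Y(φ s, ψ s)`. -/
noncomputable def natHom (φ ψ : EnrichedFunctor V T Y) : V :=
  equalizer (precontactMap φ ψ) (postcontactMap m φ ψ)

namespace natHom

/-- The inclusion of natural transforms in all transforms. -/
noncomputable def ι (φ ψ : EnrichedFunctor V T Y) :
    natHom m φ ψ ⟶ ∏ᶜ fun s : T => (φ.obj s ⟶[V] ψ.obj s) :=
  equalizer.ι _ _

/-- The component at `s` of a natural transform. -/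
noncomputable def π (φ ψ : EnrichedFunctor V T Y) (s : T) :
    natHom m φ ψ ⟶ (φ.obj s ⟶[V] ψ.obj s) :=
  ι m φ ψ ≫ Pi.π _ s

theorem condition (φ ψ : EnrichedFunctor V T Y) (s t : T) :
    π m φ ψ s ▷ (s ⟶[V] t) ≫ precontact φ ψ s t =
      π m φ ψ t ▷ (s ⟶[V] t) ≫ postcontact m φ ψ s t := by
  apply (nameEquiv _ _ _).injective
  rw [← comp_nameEquiv, ← comp_nameEquiv, π, π, Category.assoc, Category.assoc]
  have h : ι m φ ψ ≫ precontactMap φ ψ = ι m φ ψ ≫ postcontactMap m φ ψ :=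
    equalizer.condition _ _
  have h' := congrArg (· ≫ Pi.π _ (s, t)) h
  simpa only [Category.assoc, precontactMap, postcontactMap, Pi.lift_π] using h'

variable {m} in
theorem hom_ext {r : V} {φ ψ : EnrichedFunctor V T Y} {f g : r ⟶ natHom m φ ψ}
    (h : ∀ s, f ≫ π m φ ψ s = g ≫ π m φ ψ s) : f = g := by
  have h' : f ≫ ι m φ ψ = g ≫ ι m φ ψ := by
    apply Pi.hom_ext
    intro s
    rw [Category.assoc, Category.assoc]
    exact h s
  exact equalizer.hom_ext h'

/-- The arrow into the object of natural transforms with prescribed components. -/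
noncomputable def lift {r : V} (φ ψ : EnrichedFunctor V T Y)
    (a : ∀ s : T, r ⟶ (φ.obj s ⟶[V] ψ.obj s))
    (h : ∀ s t, a s ▷ (s ⟶[V] t) ≫ precontact φ ψ s t =
      a t ▷ (s ⟶[V] t) ≫ postcontact m φ ψ s t) :
    r ⟶ natHom m φ ψ :=
  equalizer.lift (Pi.lift a) (by
    apply Pi.hom_ext
    rintro ⟨s, t⟩
    rw [Category.assoc, Category.assoc, precontactMap, postcontactMap, Pi.lift_π, Pi.lift_π,
      Pi.lift_π_assoc, Pi.lift_π_assoc, comp_nameEquiv, comp_nameEquiv, h])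

theorem lift_π {r : V} (φ ψ : EnrichedFunctor V T Y)
    (a : ∀ s : T, r ⟶ (φ.obj s ⟶[V] ψ.obj s))
    (h : ∀ s t, a s ▷ (s ⟶[V] t) ≫ precontact φ ψ s t =
      a t ▷ (s ⟶[V] t) ≫ postcontact m φ ψ s t) (s : T) :
    lift m φ ψ a h ≫ π m φ ψ s = a s := by
  have h' : lift m φ ψ a h ≫ ι m φ ψ = Pi.lift a := equalizer.lift_ι _ _
  rw [π, reassoc_of% h', Pi.lift_π]

theorem eqToHom_π {φ φ' ψ ψ' : EnrichedFunctor V T Y} (h₁ : φ = φ') (h₂ : ψ = ψ')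
    (h : natHom m φ ψ = natHom m φ' ψ') (s : T) :
    eqToHom h ≫ π m φ' ψ' s = π m φ ψ s ≫ eqToHom (by rw [h₁, h₂]) := by
  subst h₁ h₂; simp

theorem comp_aux (φ ψ χ : EnrichedFunctor V T Y) (s t : T) :
    ((natHom.π m φ ψ s ⊗ₘ natHom.π m ψ χ s) ≫ eComp V _ _ _) ▷ (s ⟶[V] t) ≫ precontact φ χ s t =
    ((natHom.π m φ ψ t ⊗ₘ natHom.π m ψ χ t) ≫ eComp V _ _ _) ▷ (s ⟶[V] t) ≫
      postcontact m φ χ s t := by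
  have c1 := natHom.condition m φ ψ s t
  have c2 := natHom.condition m ψ χ s t
  have n := m.swap_naturality (natHom.π m ψ χ t) (𝟙 (s ⟶[V] t))
  simp only [tensorHom_id, id_tensorHom] at n
  simp only [comp_whiskerRight, Category.assoc, comp_precontact, comp_postcontact]
  calc _ = (α_ _ _ _).hom ≫ natHom.π m φ ψ s ▷ _ ≫ _ ◁ (natHom.π m ψ χ s ▷ (s ⟶[V] t) ≫ precontact ψ χ s t) ≫ eComp V _ _ _ := by
        simp [MonoidalCategory.tensorHom_def]
    _ = (α_ _ _ _).hom ≫ _ ◁ m.swap _ _ ≫ (α_ _ _ _).inv ≫ (natHom.π m φ ψ s ▷ (s ⟶[V] t) ≫ precontact φ ψ s t) ▷ _ ≫ _ ◁ natHom.π m ψ χ t ≫ eComp V _ _ _ := by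
        rw [c2, MonoidalCategory.whiskerLeft_comp, Category.assoc, whisker_postcontact, ← MonoidalCategory.whiskerLeft_comp_assoc, n]
        simp only [MonoidalCategory.whiskerLeft_comp, Category.assoc, comp_whiskerRight]
        simp only [← whisker_exchange_assoc]
        simp
    _ = _ := by
        rw [c1]
        simp only [MonoidalCategory.tensorHom_def', comp_whiskerRight, Category.assoc]
        rw [associator_naturality_left_assoc, associator_naturality_middle_assoc]
        have e := whisker_exchange (natHom.π m φ ψ t)
          (m.swap (ψ.obj t ⟶[V] χ.obj t) (s ⟶[V] t))
        rw [← reassoc_of% e, ← MonoidalCategory.whiskerLeft_comp_assoc, n]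
        simp only [← whisker_exchange_assoc]
        simp

/-- The identity transform; its components are the units of `Y`. -/
noncomputable def id (φ : EnrichedFunctor V T Y) : 𝟙_ V ⟶ natHom m φ φ :=
  natHom.lift m φ φ (fun s => eId V (φ.obj s)) (by
    intro s t
    unfold precontact postcontact
    have n := m.swap_naturality (eId V (φ.obj t)) (𝟙 (s ⟶[V] t))
    simp only [tensorHom_id, id_tensorHom] at n
    rw [reassoc_of% n, m.swap_unit_left, whisker_exchange_assoc, ← whisker_exchange_assoc]
    have h1 := e_id_comp V (φ.obj s) (φ.obj t)
    have h2 := e_comp_id V (φ.obj s) (φ.obj t)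
    rw [Iso.inv_comp_eq] at h1 h2
    rw [h1, h2]
    simp)

/-- Composition of natural transforms; componentwise it is the composition of `Y`. -/
noncomputable def comp (φ ψ χ : EnrichedFunctor V T Y) :
    natHom m φ ψ ⊗ natHom m ψ χ ⟶ natHom m φ χ :=
  natHom.lift m φ χ
    (fun s => (natHom.π m φ ψ s ⊗ₘ natHom.π m ψ χ s) ≫ eComp V _ _ _) (comp_aux m φ ψ χ)

theorem id_π (φ : EnrichedFunctor V T Y) (s : T) : id m φ ≫ π m φ φ s = eId V (φ.obj s) :=
  lift_π ..

theorem comp_π (φ ψ χ : EnrichedFunctor V T Y) (s : T) :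
    comp m φ ψ χ ≫ π m φ χ s = (π m φ ψ s ⊗ₘ π m ψ χ s) ≫ eComp V _ _ _ :=
  lift_π ..

theorem id_π_assoc (φ : EnrichedFunctor V T Y) (s : T) {r : V} (f : (φ.obj s ⟶[V] φ.obj s) ⟶ r) :
    id m φ ≫ π m φ φ s ≫ f = eId V (φ.obj s) ≫ f := by
  rw [← Category.assoc, id_π]

theorem comp_π_assoc (φ ψ χ : EnrichedFunctor V T Y) (s : T) {r : V}
    (f : (φ.obj s ⟶[V] χ.obj s) ⟶ r) :
    comp m φ ψ χ ≫ π m φ χ s ≫ f = (π m φ ψ s ⊗ₘ π m ψ χ s) ≫ eComp V _ _ _ ≫ f := by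
  rw [← Category.assoc, comp_π, Category.assoc]

theorem id_comp (φ ψ : EnrichedFunctor V T Y) :
    (λ_ (natHom m φ ψ)).inv ≫ id m φ ▷ _ ≫ comp m φ φ ψ = 𝟙 _ := by
  apply natHom.hom_ext; intro s
  have := e_id_comp V (φ.obj s) (ψ.obj s)
  rw [Iso.inv_comp_eq] at this
  rw [Category.assoc, Category.assoc, comp_π, whiskerRight_comp_tensorHom_assoc, id_π,
    MonoidalCategory.tensorHom_def', Category.assoc, this]
  simp

theorem comp_id (φ ψ : EnrichedFunctor V T Y) :
    (ρ_ (natHom m φ ψ)).inv ≫ _ ◁ id m ψ ≫ comp m φ ψ ψ = 𝟙 _ := by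
  apply natHom.hom_ext; intro s
  have := e_comp_id V (φ.obj s) (ψ.obj s)
  rw [Iso.inv_comp_eq] at this
  rw [Category.assoc, Category.assoc, comp_π, whiskerLeft_comp_tensorHom_assoc, id_π,
    MonoidalCategory.tensorHom_def, Category.assoc, this]
  simp

theorem assoc (φ ψ χ ω : EnrichedFunctor V T Y) :
    (α_ _ _ _).inv ≫ comp m φ ψ χ ▷ _ ≫ comp m φ χ ω =
      natHom m φ ψ ◁ comp m ψ χ ω ≫ comp m φ ψ ω := by
  apply natHom.hom_ext; intro s
  have h := e_assoc' V (φ.obj s) (ψ.obj s) (χ.obj s) (ω.obj s)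
  have n := associator_naturality (natHom.π m φ ψ s) (natHom.π m ψ χ s) (natHom.π m χ ω s)
  rw [Category.assoc, Category.assoc, Category.assoc, comp_π, comp_π,
    whiskerRight_comp_tensorHom_assoc, whiskerLeft_comp_tensorHom_assoc, comp_π, comp_π,
    ← tensorHom_comp_whiskerRight, ← tensorHom_comp_whiskerLeft, Category.assoc, Category.assoc,
    ← h, reassoc_of% n, Iso.inv_hom_id_assoc]

end natHom

/-- The objects of the exponential `Y ^ (T)`: the `V`-functors from `T` to `Y`. -/
def Exponential (_ : RelatorInvolution V) (T : Type t) [EnrichedCategory V T] (Y : Type y)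
    [EnrichedCategory V Y] := EnrichedFunctor V T Y

namespace Exponential


/-- The `V`-category `Y ^ (T)` of `V`-functors and objects of natural transforms. -/
noncomputable instance : EnrichedCategory V (Exponential m T Y) where
  Hom φ ψ := natHom m φ ψ
  id φ := natHom.id m φ
  comp φ ψ χ := natHom.comp m φ ψ χ
  id_comp φ ψ := natHom.id_comp m φ ψ
  comp_id φ ψ := natHom.comp_id m φ ψ
  assoc φ ψ χ ω := natHom.assoc m φ ψ χ ω

theorem mapHom_aux (f : EnrichedFunctor V Y Y') (φ ψ : EnrichedFunctor V T Y) (s t : T) :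
    (natHom.π m φ ψ s ≫ f.map _ _) ▷ (s ⟶[V] t) ≫ precontact (φ.comp V f) (ψ.comp V f) s t =
    (natHom.π m φ ψ t ≫ f.map _ _) ▷ (s ⟶[V] t) ≫
      postcontact m (φ.comp V f) (ψ.comp V f) s t := by
  rw [comp_whiskerRight, comp_whiskerRight]
  refine (Category.assoc _ _ _).trans (Eq.trans ?_ (Category.assoc _ _ _).symm)
  rw [comp_precontact_target, comp_postcontact_target]
  have h := congrArg (· ≫ f.map (φ.obj s) (ψ.obj t)) (natHom.condition m φ ψ s t)
  simp only [Category.assoc] at h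
  exact h

/-- The arrow of natural transforms given by applying `f` to every component. -/
noncomputable def mapHom (f : EnrichedFunctor V Y Y') (φ ψ : EnrichedFunctor V T Y) :
    natHom m φ ψ ⟶ natHom m (φ.comp V f) (ψ.comp V f) :=
  natHom.lift m (φ.comp V f) (ψ.comp V f) (fun s => natHom.π m φ ψ s ≫ f.map _ _)
    (mapHom_aux m f φ ψ)

theorem mapHom_π (f : EnrichedFunctor V Y Y') (φ ψ : EnrichedFunctor V T Y) (s : T) :
    mapHom m f φ ψ ≫ natHom.π m (φ.comp V f) (ψ.comp V f) s = natHom.π m φ ψ s ≫ f.map _ _ :=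
  natHom.lift_π ..

theorem mapHom_id (f : EnrichedFunctor V Y Y') (φ : EnrichedFunctor V T Y) :
    natHom.id m φ ≫ mapHom m f φ φ = natHom.id m (φ.comp V f) := by
  apply natHom.hom_ext
  intro s
  rw [Category.assoc, mapHom_π, natHom.id_π]
  exact (natHom.id_π_assoc ..).trans (f.map_id _)

theorem mapHom_comp (f : EnrichedFunctor V Y Y') (φ ψ χ : EnrichedFunctor V T Y) :
    natHom.comp m φ ψ χ ≫ mapHom m f φ χ = (mapHom m f φ ψ ⊗ₘ mapHom m f ψ χ) ≫
      natHom.comp m (φ.comp V f) (ψ.comp V f) (χ.comp V f) := by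
  apply natHom.hom_ext
  intro s
  rw [Category.assoc, mapHom_π, Category.assoc, natHom.comp_π, tensorHom_comp_tensorHom_assoc,
    mapHom_π, mapHom_π]
  change natHom.comp m φ ψ χ ≫ natHom.π m φ χ s ≫ f.map (φ.obj s) (χ.obj s) =
    (_ ⊗ₘ _) ≫ eComp V (f.obj (φ.obj s)) (f.obj (ψ.obj s)) (f.obj (χ.obj s))
  rw [natHom.comp_π_assoc, f.map_comp, tensorHom_comp_tensorHom_assoc]

variable (T) in
/-- The change of target `f ^ (T) : Y ^ (T) ⟶ Y' ^ (T)`, `φ ↦ φ` followed by `f`. -/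
noncomputable def map (f : EnrichedFunctor V Y Y') :
    EnrichedFunctor V (Exponential m T Y) (Exponential m T Y') where
  obj φ := EnrichedFunctor.comp V φ f
  map φ ψ := mapHom m f φ ψ
  map_id φ := mapHom_id m f φ
  map_comp φ ψ χ := mapHom_comp m f φ ψ χ

end Exponential

end exp

section sec
universe x t y x' y'
variable {V : Type u} [Category.{v} V] [MonoidalCategory V] (m : RelatorInvolution V)
variable {X : Type x} [EnrichedCategory V X] (T : Type t) [EnrichedCategory V T]
  {Y : Type y} [EnrichedCategory V Y]

theorem Biproduct.map_id' (X : Type x) [EnrichedCategory V X] :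
    Biproduct.map m T (EnrichedFunctor.id V X) = EnrichedFunctor.id V (Biproduct m X T) :=
  EnrichedFunctor.ext V (fun _ => rfl) (fun a b => by
    change (𝟙 (a.1 ⟶[V] b.1) ▷ (a.2 ⟶[V] b.2)) ≫ 𝟙 _ = 𝟙 _
    simp)

theorem Biproduct.map_comp' {X' : Type x'} [EnrichedCategory V X']
    (f : EnrichedFunctor V X X') (g : EnrichedFunctor V X' Y) :
    Biproduct.map m T (f.comp V g) = (Biproduct.map m T f).comp V (Biproduct.map m T g) :=
  EnrichedFunctor.ext V (fun _ => rfl) (fun a b => by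
    change ((f.map a.1 b.1 ≫ g.map _ _) ▷ (a.2 ⟶[V] b.2)) ≫ 𝟙 _ =
      f.map a.1 b.1 ▷ (a.2 ⟶[V] b.2) ≫ g.map _ _ ▷ (a.2 ⟶[V] b.2)
    simp)

theorem eId_eId (a : X) : (eId V a ⊗ₘ eId V a) ≫ eComp V a a a = (λ_ _).hom ≫ eId V a := by
  have h := e_id_comp V a a
  rw [Iso.inv_comp_eq] at h
  rw [MonoidalCategory.tensorHom_def', Category.assoc, h]; simp

theorem eId_comp' (a b : X) : eId V a ▷ _ ≫ eComp V a a b = (λ_ _).hom := by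
  have h := e_id_comp V a b
  rw [Iso.inv_comp_eq] at h
  simpa using h

theorem comp_eId (a b : X) : _ ◁ eId V b ≫ eComp V a b b = (ρ_ _).hom := by
  have h := e_comp_id V a b
  rw [Iso.inv_comp_eq] at h
  simpa using h

variable {T} in
/-- The section at `a`: the `V`-functor `T ⟶ X ⊗ T`, `s ↦ (a, s)`, given on hom-objects by
`1_a ⊗ id : T(s, t) ⟶ X(a, a) ⊗ T(s, t)`. -/
def sectionObj (a : X) : EnrichedFunctor V T (Biproduct m X T) where
  obj s := ⟨a, s⟩
  map s t := (λ_ (s ⟶[V] t)).inv ≫ eId V a ▷ (s ⟶[V] t)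
  map_id s := by
    change eId V s ≫ (λ_ (s ⟶[V] s)).inv ≫ eId V a ▷ (s ⟶[V] s) =
      (λ_ (𝟙_ V)).inv ≫ (eId V a ⊗ₘ eId V s)
    rw [MonoidalCategory.tensorHom_def']; simp
  map_comp s t r := by
    change eComp V s t r ≫ (λ_ (s ⟶[V] r)).inv ≫ eId V a ▷ (s ⟶[V] r) =
      (_ ⊗ₘ _) ≫ m.hom _ _ _ _ ≫ (eComp V a a a ⊗ₘ eComp V s t r)
    have n := m.naturality (eId V a) (𝟙 (s ⟶[V] t)) (eId V a) (𝟙 (t ⟶[V] r))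
    simp only [tensorHom_id] at n
    rw [← tensorHom_comp_tensorHom_assoc, reassoc_of% n, m.hom_I_x_I_x]
    simp only [tensorHom_comp_tensorHom, eId_eId, Category.assoc]
    rw [MonoidalCategory.tensorHom_def' (_ ≫ _)]
    simp [tensorHom_comp_tensorHom_assoc]

theorem precontact_section (a b : X) (s t : T) :
    ((ρ_ (a ⟶[V] b)).inv ≫ _ ◁ eId V s) ▷ (s ⟶[V] t) ≫
      precontact (sectionObj m a) (sectionObj m b) s t = 𝟙 _ := by
  change _ ≫ _ ◁ (_ ≫ _) ≫ m.hom _ _ _ _ ≫ (eComp V a b b ⊗ₘ eComp V s s t) = _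
  have n := m.naturality (𝟙 (a ⟶[V] b)) (eId V s) (eId V b) (𝟙 (s ⟶[V] t))
  simp only [tensorHom_id, id_tensorHom] at n
  rw [← tensorHom_def_assoc, ← tensorHom_comp_tensorHom_assoc, reassoc_of% n, m.middle_unitality]
  simp [tensorHom_comp_tensorHom, comp_eId, eId_comp']

theorem postcontact_section (a b : X) (s t : T) :
    ((ρ_ (a ⟶[V] b)).inv ≫ _ ◁ eId V t) ▷ (s ⟶[V] t) ≫
      postcontact m (sectionObj m a) (sectionObj m b) s t = 𝟙 _ := by
  change _ ≫ m.swap (_ ⊗ _) _ ≫ (_ ≫ _) ▷ _ ≫ m.hom _ _ _ _ ≫ (eComp V a a b ⊗ₘ eComp V s t t) = _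
  have n := m.swap_naturality ((ρ_ (a ⟶[V] b)).inv ≫ (a ⟶[V] b) ◁ eId V t) (𝟙 (s ⟶[V] t))
  have n' := m.naturality (eId V a) (𝟙 (s ⟶[V] t)) (𝟙 (a ⟶[V] b)) (eId V t)
  simp only [tensorHom_id, id_tensorHom] at n n'
  rw [reassoc_of% n, ← tensorHom_def'_assoc, ← tensorHom_comp_tensorHom_assoc, reassoc_of% n',
    m.hom_I_x_x_I]
  simp [tensorHom_comp_tensorHom, tensorHom_comp_tensorHom_assoc, comp_eId, eId_comp', m.swap_swap]

theorem section_aux (a b : X) (s t : T) :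
    ((ρ_ (a ⟶[V] b)).inv ≫ _ ◁ eId V s) ▷ (s ⟶[V] t) ≫
      precontact (sectionObj m a) (sectionObj m b) s t =
    ((ρ_ (a ⟶[V] b)).inv ≫ _ ◁ eId V t) ▷ (s ⟶[V] t) ≫
      postcontact m (sectionObj m a) (sectionObj m b) s t :=
  (precontact_section m T a b s t).trans (postcontact_section m T a b s t).symm

theorem section_comp_aux {T : Type t} [EnrichedCategory V T] (a b c : X) (s : T) :
    eComp V a b c ≫ (ρ_ (a ⟶[V] c)).inv ≫ _ ◁ eId V s =
      (((ρ_ (a ⟶[V] b)).inv ≫ _ ◁ eId V s) ⊗ₘ ((ρ_ (b ⟶[V] c)).inv ≫ _ ◁ eId V s)) ≫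
        m.hom _ _ _ _ ≫ (eComp V a b c ⊗ₘ eComp V s s s) := by
  have n := m.naturality (𝟙 (a ⟶[V] b)) (eId V s) (𝟙 (b ⟶[V] c)) (eId V s)
  simp only [id_tensorHom] at n
  rw [← tensorHom_comp_tensorHom_assoc, reassoc_of% n, m.hom_x_I_x_I,
    MonoidalCategory.whiskerLeft_id, tensorHom_comp_tensorHom, eId_eId, Category.id_comp,
    MonoidalCategory.tensorHom_def (eComp V a b c)]
  simp only [tensorHom_comp_tensorHom_assoc, Iso.inv_hom_id, id_tensorHom_id, Category.id_comp,
    MonoidalCategory.whiskerLeft_comp, Category.assoc]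
  rw [whisker_exchange_assoc, whiskerLeft_inv_hom_assoc, rightUnitor_inv_naturality_assoc]

theorem comp_four {p q r s : V} (a b c d e : Y) (f : p ⟶ (a ⟶[V] b)) (g : q ⟶ (b ⟶[V] c))
    (h : r ⟶ (c ⟶[V] d)) (k : s ⟶ (d ⟶[V] e)) :
    ((f ⊗ₘ g) ⊗ₘ (h ⊗ₘ k)) ≫ (eComp V a b c ⊗ₘ eComp V c d e) ≫ eComp V a c e =
      (α_ p q (r ⊗ s)).hom ≫ p ◁ (α_ q r s).inv ≫
        (f ⊗ₘ (((g ⊗ₘ h) ≫ eComp V b c d) ⊗ₘ k)) ≫ _ ◁ eComp V b d e ≫ eComp V a b e := by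
  have e0 : (eComp V a b c ⊗ₘ eComp V c d e) ≫ eComp V a c e = (α_ _ _ _).hom ≫
      _ ◁ (α_ _ _ _).inv ≫ _ ◁ (eComp V b c d ▷ _) ≫ _ ◁ eComp V b d e ≫ eComp V a b e := by
    rw [MonoidalCategory.tensorHom_def', Category.assoc, ← e_assoc' V a b c e,
      ← MonoidalCategory.whiskerLeft_comp_assoc _ (eComp V b c d ▷ _), ← e_assoc' V b c d e]
    simp
  have e1 : (f ⊗ₘ (((g ⊗ₘ h) ≫ eComp V b c d) ⊗ₘ k)) =
      (f ⊗ₘ ((g ⊗ₘ h) ⊗ₘ k)) ≫ _ ◁ (eComp V b c d ▷ _) := by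
    rw [tensorHom_comp_whiskerLeft, tensorHom_comp_whiskerRight]
  have e2 := associator_inv_naturality g h k
  have e3 := associator_naturality f g (h ⊗ₘ k)
  rw [e0, e1, Category.assoc, reassoc_of% e3, tensorHom_comp_whiskerLeft_assoc, e2,
    ← whiskerLeft_comp_tensorHom_assoc]

variable [HasProducts.{t} V] [HasEqualizers V] [∀ s : V, (tensorRight s).IsLeftAdjoint]

theorem Exponential.map_id' (Y : Type y) [EnrichedCategory V Y] :
    Exponential.map m T (EnrichedFunctor.id V Y) = EnrichedFunctor.id V (Exponential m T Y) := by
  have h (φ : EnrichedFunctor V T Y) : φ.comp V (EnrichedFunctor.id V Y) = φ :=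
    EnrichedFunctor.ext V (fun _ => rfl) (fun _ _ => by simp [EnrichedFunctor.comp, EnrichedFunctor.id])
  have key (φ ψ : EnrichedFunctor V T Y) : mapHom m (EnrichedFunctor.id V Y) φ ψ ≫
      eqToHom (congrArg₂ (natHom m) (h φ) (h ψ)) = 𝟙 (natHom m φ ψ) := by
    apply natHom.hom_ext
    intro s
    rw [Category.assoc, natHom.eqToHom_π m (h φ) (h ψ),
      reassoc_of% (mapHom_π m (EnrichedFunctor.id V Y) φ ψ s)]
    change (natHom.π m φ ψ s ≫ 𝟙 _) ≫ 𝟙 _ = _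
    simp
  exact EnrichedFunctor.ext V h key

theorem Exponential.map_comp' {Y' : Type y'} [EnrichedCategory V Y'] {Y'' : Type x'} [EnrichedCategory V Y'']
    (f : EnrichedFunctor V Y Y') (g : EnrichedFunctor V Y' Y'') :
    Exponential.map m T (f.comp V g) =
      (Exponential.map m T f).comp V (Exponential.map m T g) := by
  have h (φ : EnrichedFunctor V T Y) : φ.comp V (f.comp V g) = (φ.comp V f).comp V g :=
    EnrichedFunctor.ext V (fun _ => rfl) (fun _ _ => by simp [EnrichedFunctor.comp])
  have key (φ ψ : EnrichedFunctor V T Y) : mapHom m (f.comp V g) φ ψ ≫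
      eqToHom (congrArg₂ (natHom m) (h φ) (h ψ)) =
        mapHom m f φ ψ ≫ mapHom m g (φ.comp V f) (ψ.comp V f) := by
    apply natHom.hom_ext
    intro s
    rw [Category.assoc, Category.assoc, natHom.eqToHom_π m (h φ) (h ψ),
      reassoc_of% (mapHom_π m (f.comp V g) φ ψ s), mapHom_π]
    have e := congrArg (· ≫ g.map (f.obj (φ.obj s)) (f.obj (ψ.obj s))) (mapHom_π m f φ ψ s)
    simp only [Category.assoc] at e
    refine Eq.trans ?_ (e.symm.trans (Category.assoc _ _ _))
    change (natHom.π m φ ψ s ≫ (f.map _ _ ≫ g.map _ _)) ≫ 𝟙 _ = _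
    rw [Category.comp_id]
  exact EnrichedFunctor.ext V h key

/-- The arrow from `X(a, b)` to natural transforms of sections with components `id ⊗ 1_s`. -/
noncomputable def sectionMap (a b : X) : (a ⟶[V] b) ⟶ natHom m (sectionObj (T := T) m a) (sectionObj m b) :=
  natHom.lift m _ _ (fun s => (ρ_ (a ⟶[V] b)).inv ≫ _ ◁ eId V s) (section_aux m T a b)

theorem sectionMap_π (a b : X) (s : T) : sectionMap m T a b ≫ natHom.π m _ _ s = (ρ_ (a ⟶[V] b)).inv ≫ _ ◁ eId V s :=
  natHom.lift_π ..

variable (X) in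
/-- The `V`-functor `X ⟶ (X ⊗ T) ^ (T)` taking `a` to its section. -/
noncomputable def sectionsFunctor : EnrichedFunctor V X (Exponential m T (Biproduct m X T)) where
  obj a := sectionObj m a
  map a b := sectionMap m T a b
  map_id a := by
    change eId V a ≫ sectionMap m T a a = natHom.id m (sectionObj m a)
    apply natHom.hom_ext
    intro s
    rw [Category.assoc, sectionMap_π, natHom.id_π]
    change _ = (λ_ (𝟙_ V)).inv ≫ (eId V a ⊗ₘ eId V s)
    rw [MonoidalCategory.tensorHom_def]
    simp [unitors_inv_equal]
    rfl
  map_comp a b c := by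
    change eComp V a b c ≫ sectionMap m T a c =
      (sectionMap m T a b ⊗ₘ sectionMap m T b c) ≫
        natHom.comp m (sectionObj m a) (sectionObj m b) (sectionObj m c)
    apply natHom.hom_ext
    intro s
    rw [Category.assoc, Category.assoc, sectionMap_π, natHom.comp_π, tensorHom_comp_tensorHom_assoc,
      sectionMap_π, sectionMap_π]
    exact section_comp_aux m a b c s

theorem ev_id_aux (φ : EnrichedFunctor V T Y) (s : T) :
    (natHom.id m φ ⊗ₘ eId V s) ≫ natHom.π m φ φ s ▷ _ ≫ precontact φ φ s s =
      (λ_ (𝟙_ V)).hom ≫ eId V (φ.obj s) := by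
  rw [← tensorHom_id, tensorHom_comp_tensorHom_assoc, natHom.id_π, precontact, tensorHom_def_assoc,
   ← MonoidalCategory.whiskerLeft_comp_assoc, Category.comp_id, φ.map_id, ← eId_eId,
   MonoidalCategory.tensorHom_def, Category.assoc]

theorem ev_comp_aux (φ ψ χ : EnrichedFunctor V T Y) (s t r : T) :
    m.hom _ _ _ _ ≫ (natHom.comp m φ ψ χ ⊗ₘ eComp V s t r) ≫ natHom.π m φ χ s ▷ _ ≫
        precontact φ χ s r =
      ((natHom.π m φ ψ s ▷ (s ⟶[V] t) ≫ precontact φ ψ s t) ⊗ₘ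
        (natHom.π m ψ χ t ▷ (t ⟶[V] r) ≫ precontact ψ χ t r)) ≫ eComp V _ _ _ := by
  have n := m.swap_naturality (natHom.π m ψ χ t) (𝟙 (s ⟶[V] t))
  simp only [tensorHom_id, id_tensorHom] at n
  have c2 : m.swap (s ⟶[V] t) (natHom m ψ χ) ≫ (natHom.π m ψ χ s ⊗ₘ χ.map s t) ≫ eComp V _ _ _ =
      (ψ.map s t ⊗ₘ natHom.π m ψ χ t) ≫ eComp V _ _ _ := by
    have c := natHom.condition m ψ χ s t
    rw [precontact, ← tensorHom_def_assoc, postcontact, reassoc_of% n] at c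
    rw [c, reassoc_of% m.swap_swap, ← tensorHom_def'_assoc]
  have l : (natHom.comp m φ ψ χ ⊗ₘ eComp V s t r) ≫ natHom.π m φ χ s ▷ _ ≫ precontact φ χ s r =
      ((natHom.π m φ ψ s ⊗ₘ natHom.π m ψ χ s) ⊗ₘ (χ.map s t ⊗ₘ χ.map t r)) ≫
        (eComp V _ _ _ ⊗ₘ eComp V _ _ _) ≫ eComp V _ _ _ := by
    rw [precontact, ← tensorHom_def_assoc, tensorHom_comp_tensorHom_assoc, natHom.comp_π,
      χ.map_comp, ← tensorHom_comp_tensorHom_assoc]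
  rw [l, comp_four, m.hom_eq, precontact, precontact, ← MonoidalCategory.tensorHom_def_assoc,
    ← MonoidalCategory.tensorHom_def_assoc, ← tensorHom_comp_tensorHom_assoc, comp_four, ← c2]
  simp only [Category.assoc, Iso.inv_hom_id_assoc, whiskerLeft_hom_inv_assoc]
  rw [← whiskerRight_comp_tensorHom (m.swap _ _), ← whiskerLeft_comp_tensorHom_assoc]

variable (Y) in
/-- The evaluation `Y ^ (T) ⊗ T ⟶ Y`, `(φ, s) ↦ φ s`, given on hom-objects by the precontact
arrows. -/
noncomputable def evaluationFunctor : EnrichedFunctor V (Biproduct m (Exponential m T Y) T) Y where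
  obj p := EnrichedFunctor.obj p.1 p.2
  map p q := natHom.π m p.1 q.1 p.2 ▷ (p.2 ⟶[V] q.2) ≫ precontact p.1 q.1 p.2 q.2
  map_id p := by
    change ((λ_ (𝟙_ V)).inv ≫ (natHom.id m p.1 ⊗ₘ eId V p.2)) ≫ _ = _
    rw [Category.assoc]
    exact (Iso.inv_comp_eq _).2 (ev_id_aux m T p.1 p.2)
  map_comp p q r := by
    change (m.hom _ _ _ _ ≫ (natHom.comp m p.1 q.1 r.1 ⊗ₘ eComp V p.2 q.2 r.2)) ≫ _ = _
    rw [Category.assoc]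
    exact ev_comp_aux m T p.1 q.1 r.1 p.2 q.2 r.2
end sec

section functors
variable {V : Type u} [Category.{v} V] [MonoidalCategory V]

/-- An original `V`-graph: vertices, edge objects in `V`, and chosen unit arrows. -/
structure OGrph (V : Type u) [Category.{v} V] [MonoidalCategory V] where
  /-- the vertices -/
  vertex : Type w
  /-- the object of edges between two vertices -/
  edge : vertex → vertex → V
  /-- the chosen unit arrows -/
  unit : ∀ a, 𝟙_ V ⟶ edge a a

namespace OGrph
universe x y

/-- A transport of original `V`-graphs: it preserves the chosen unit arrows. -/
@[ext]
structure Transport (X : OGrph.{x} V) (Y : OGrph.{y} V) where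
  /-- the action on vertices -/
  obj : X.vertex → Y.vertex
  /-- the action on edges -/
  map : ∀ a b, X.edge a b ⟶ Y.edge (obj a) (obj b)
  /-- units go to units -/
  map_unit : ∀ a, X.unit a ≫ map a a = Y.unit (obj a)

/-- Composition of transports. -/
def Transport.comp {T : OGrph.{w} V} {X : OGrph.{x} V} {Y : OGrph.{y} V} (f : Transport T X) (g : Transport X Y) :
    Transport T Y where
  obj a := g.obj (f.obj a)
  map a b := f.map a b ≫ g.map _ _
  map_unit a := by rw [← Category.assoc, f.map_unit, g.map_unit]

/-- The category of original `V`-graphs and transports. -/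
instance : Category (OGrph.{x} V) where
  Hom X Y := Transport X Y
  id X := ⟨fun a => a, fun _ _ => 𝟙 _, fun _ => Category.comp_id _⟩
  comp f g := Transport.comp f g
  id_comp f := by simp [Transport.comp]
  comp_id f := by simp [Transport.comp]
  assoc f g h := by simp [Transport.comp]

/-- The biproduct of original `V`-graphs. -/
def tensor (X : OGrph.{x} V) (T : OGrph.{w} V) : OGrph.{max x w} V where
  vertex := X.vertex × T.vertex
  edge p q := X.edge p.1 q.1 ⊗ T.edge p.2 q.2
  unit p := (λ_ (𝟙_ V)).inv ≫ (X.unit p.1 ⊗ₘ T.unit p.2)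

/-- The transport `f ⊗ 1_T`. -/
def tensorMap {X Y : OGrph.{x} V} (f : X ⟶ Y) (T : OGrph.{w} V) : tensor X T ⟶ tensor Y T where
  obj p := ⟨f.obj p.1, p.2⟩
  map p q := f.map p.1 q.1 ▷ T.edge p.2 q.2
  map_unit p := by
    have h := f.map_unit p.1
    change ((λ_ (𝟙_ V)).inv ≫ (X.unit p.1 ⊗ₘ T.unit p.2)) ≫ _ =
      (λ_ (𝟙_ V)).inv ≫ (Y.unit (f.obj p.1) ⊗ₘ T.unit p.2)
    simp [← tensorHom_id, tensorHom_comp_tensorHom, h]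

/-- The exponential `Y ^ T` of original `V`-graphs: vertices are transports, edges are all
transforms `∏ Y(φ s, ψ s)`. -/
noncomputable def exp [HasProducts.{w} V] (T : OGrph.{w} V) (Y : OGrph.{y} V) :
    OGrph.{max w v y} V where
  vertex := Transport T Y
  edge φ ψ := ∏ᶜ fun s : T.vertex => Y.edge (φ.obj s) (ψ.obj s)
  unit φ := Pi.lift fun s => Y.unit (φ.obj s)

/-- The change of target `f ^ T`. -/
noncomputable def expMap [HasProducts.{w} V] (T : OGrph.{w} V) {Y Z : OGrph.{y} V} (f : Y ⟶ Z) :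
    exp T Y ⟶ exp T Z where
  obj φ := φ.comp f
  map φ ψ := Pi.lift fun s => Pi.π _ s ≫ f.map (φ.obj s) (ψ.obj s)
  map_unit φ := by
    apply Pi.hom_ext
    intro s
    refine (Category.assoc _ _ _).trans (Eq.trans ?_ (Pi.lift_π (fun s => Z.unit (f.obj (φ.obj s))) s).symm)
    exact (congrArg (_ ≫ ·) (Pi.lift_π _ _)).trans
      ((Pi.lift_π_assoc _ _ _).trans (f.map_unit (φ.obj s)))

/-- The section at a vertex `a`, `s ↦ (a, s)`, with `1_a ⊗ id` on edges. -/
def sectionObj {X : OGrph.{x} V} {T : OGrph.{w} V} (a : X.vertex) : Transport T (tensor X T) where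
  obj s := ⟨a, s⟩
  map s t := (λ_ (T.edge s t)).inv ≫ X.unit a ▷ T.edge s t
  map_unit s := by
    change T.unit s ≫ (λ_ (T.edge s s)).inv ≫ X.unit a ▷ T.edge s s =
      (λ_ (𝟙_ V)).inv ≫ (X.unit a ⊗ₘ T.unit s)
    rw [MonoidalCategory.tensorHom_def']; simp

/-- The sections transport `X ⟶ (X ⊗ T) ^ T`, with components `id ⊗ 1_s` on edges. -/
noncomputable def sections [HasProducts.{w} V] (X : OGrph.{max w v c} V) (T : OGrph.{w} V) :
    X ⟶ exp T (tensor X T) where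
  obj a := sectionObj a
  map a b := Pi.lift fun s => (ρ_ (X.edge a b)).inv ≫ X.edge a b ◁ T.unit s
  map_unit a := by
    apply Pi.hom_ext
    intro s
    refine (Category.assoc _ _ _).trans (Eq.trans ?_ (Pi.lift_π (fun s => (λ_ (𝟙_ V)).inv ≫ (X.unit a ⊗ₘ T.unit s)) s).symm)
    refine (congrArg (_ ≫ ·) (Pi.lift_π _ _)).trans ?_
    change X.unit a ≫ (ρ_ (X.edge a a)).inv ≫ X.edge a a ◁ T.unit s =
      (λ_ (𝟙_ V)).inv ≫ (X.unit a ⊗ₘ T.unit s)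
    rw [MonoidalCategory.tensorHom_def]
    simp [unitors_inv_equal]

end OGrph

namespace VCat

/-- The underlying original `V`-graph of a `V`-category. -/
def graph (X : VCat.{w} V) : OGrph.{w} V where
  vertex := X
  edge a b := a ⟶[V] b
  unit a := eId V a

universe x y in
/-- The underlying transport of a `V`-functor. -/
def graphTransport {X : VCat.{x} V} {Y : VCat.{y} V} (f : EnrichedFunctor V X.carrier Y.carrier) :
    OGrph.Transport X.graph Y.graph where
  obj a := f.obj a
  map a b := f.map a b
  map_unit a := f.map_id a

/-- The forgetful functor from `V`-categories to original `V`-graphs. -/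
def toOGrph : VCat.{w} V ⥤ OGrph.{w} V where
  obj X := X.graph
  map f := graphTransport f

variable (m : RelatorInvolution V) (T : VCat.{w} V)

/-- The functor `- ⊗ T`. -/
def tensorFunctor : VCat.{max w v c} V ⥤ VCat.{max w v c} V where
  obj X := ⟨Biproduct m X T⟩
  map f := Biproduct.map m T f
  map_id X := Biproduct.map_id' m T X
  map_comp f g := Biproduct.map_comp' m T f g

variable [HasProducts.{w} V] [HasEqualizers V] [∀ s : V, (tensorRight s).IsLeftAdjoint]

/-- The functor `Y ↦ Y ^ (T)`. -/
noncomputable def expFunctor : VCat.{max w v c} V ⥤ VCat.{max w v c} V where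
  obj Y := ⟨Exponential m T.carrier Y⟩
  map f := Exponential.map m T.carrier f
  map_id X := Exponential.map_id' m T.carrier X
  map_comp f g := Exponential.map_comp' m T.carrier f g

/-- The sections functor `λ_X : X ⟶ (X ⊗ T) ^ (T)`. -/
noncomputable def sections (X : VCat.{max w v c} V) :
    X ⟶ (expFunctor.{c} m T).obj ((tensorFunctor.{c} m T).obj X) :=
  sectionsFunctor m X.carrier T.carrier

/-- The evaluation functor `ev_Y : Y ^ (T) ⊗ T ⟶ Y`. -/
noncomputable def ev (Y : VCat.{max w v c} V) :
    (tensorFunctor.{c} m T).obj ((expFunctor.{c} m T).obj Y) ⟶ Y :=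
  evaluationFunctor m T.carrier Y.carrier

/-- The name of `f : X ⊗ T ⟶ Y`: `λ_X` followed by `f ^ (T)`. -/
noncomputable def name {X Y : VCat.{max w v c} V} (f : (tensorFunctor.{c} m T).obj X ⟶ Y) :
    X ⟶ (expFunctor.{c} m T).obj Y :=
  sections.{c} m T X ≫ (expFunctor.{c} m T).map f

/-- The realization of `g : X ⟶ Y ^ (T)`: `g ⊗ 1_T` followed by `ev_Y`. -/
noncomputable def realization {X Y : VCat.{max w v c} V} (g : X ⟶ (expFunctor.{c} m T).obj Y) :
    (tensorFunctor.{c} m T).obj X ⟶ Y :=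
  (tensorFunctor.{c} m T).map g ≫ ev.{c} m T Y

/-- The inclusion of `Y ^ (T)` in the exponential of all transforms of transports. -/
noncomputable def expInclusion (Y : VCat.{max w v c} V) :
    toOGrph.obj ((expFunctor.{c} m T).obj Y) ⟶ OGrph.exp T.graph Y.graph where
  obj φ := graphTransport (X := T) (Y := Y) φ
  map φ ψ := natHom.ι (T := T.carrier) (Y := Y.carrier) m φ ψ
  map_unit φ := by
    apply Pi.hom_ext
    intro s
    refine (Category.assoc _ _ _).trans (Eq.trans ?_ (Pi.lift_π (fun s => eId V (EnrichedFunctor.obj φ s)) s).symm)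
    exact natHom.id_π (T := T.carrier) (Y := Y.carrier) m φ s
end VCat

end functors

/-! ### Naturality of sections and evaluation, and the triangular equalities, for `V`-categories. -/

section triangles
universe x t y x' y'
variable {V : Type u} [Category.{v} V] [MonoidalCategory V] (m : RelatorInvolution V)
variable {X : Type x} [EnrichedCategory V X] (T : Type t) [EnrichedCategory V T]
  {Y : Type y} [EnrichedCategory V Y] {X' : Type x'} [EnrichedCategory V X']
  {Y' : Type y'} [EnrichedCategory V Y']

/-! An adjunction amounts to a natural unit and a natural counit satisfying two triangular
equalities. Here these are sections and evaluation, and naming is the unit followed by the action of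
the right adjoint, so all claims about names and realizations follow formally. Four equalities of
`V`-functors carry the proof: `sectionsFunctor_naturality`, `evaluationFunctor_naturality`,
`map_sectionsFunctor_comp_evaluationFunctor` and `sectionsFunctor_comp_map_evaluationFunctor`.

In terms of elements, evaluation sends `(α, u)` with `u : s → t` to `α_s` followed by `ψ u`. The
first triangle says that `(f, 1_s)` followed by `(1_b, u)` is `(f, u)`. This is the middle unit
axiom together with the unit laws (`precontact_section`). The second says that `α_s` followed by `ψ
1_s` is `α_s`, which holds because `ψ` preserves units. Sections are natural because `V`-functors
preserve units, evaluation because they preserve composition.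

That the constructions are well defined rests on the exchange `m.swap`. The coherence axioms force
the interchange to be the exchange of the two middle factors (`RelatorInvolution.hom_eq`), and the
exchange is natural, self-inverse and satisfies a hexagon. The hexagon is what makes composites of
natural transforms natural (`natHom.comp_aux`). The equalizer condition, which trades precontact for
postcontact, makes evaluation preserve composition (`ev_comp_aux`).

Equality of `V`-functors is checked on objects, then on hom-objects up to an `eqToHom` between them.
Objects of `Y ^ (T)` are themselves `V`-functors, often only propositionally equal. Components are
jointly monic (`natHom.hom_ext`), and `natHom.eqToHom_π` moves the `eqToHom` past a component, where
it is an identity by definition. -/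

theorem sectionObj_comp_map (f : EnrichedFunctor V X X') (a : X) :
    (sectionObj (T := T) m a).comp V (Biproduct.map m T f) = sectionObj m (f.obj a) :=
  EnrichedFunctor.ext V (fun _ => rfl) (fun s t => by
    change (((λ_ (s ⟶[V] t)).inv ≫ eId V a ▷ (s ⟶[V] t)) ≫ f.map a a ▷ (s ⟶[V] t)) ≫ 𝟙 _ =
      (λ_ (s ⟶[V] t)).inv ≫ eId V (f.obj a) ▷ (s ⟶[V] t)
    rw [Category.comp_id, Category.assoc, ← comp_whiskerRight, f.map_id])

variable [HasProducts.{t} V] [HasEqualizers V] [∀ s : V, (tensorRight s).IsLeftAdjoint]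

/-- Evaluating the identity transform of `φ` along `u` gives `1_{φ s}` followed by `φ u`, so the
left unit law of `Y` suffices. This is the object part of the second triangular equality. -/
theorem sectionObj_comp_evaluation (φ : EnrichedFunctor V T Y) :
    (sectionObj (X := Exponential m T Y) (T := T) m φ).comp V (evaluationFunctor m T Y) = φ :=
  EnrichedFunctor.ext V (fun _ => rfl) (fun s t => by
    change (((λ_ (s ⟶[V] t)).inv ≫ natHom.id m φ ▷ (s ⟶[V] t)) ≫
      natHom.π m φ φ s ▷ (s ⟶[V] t) ≫ precontact φ φ s t) ≫ 𝟙 _ = φ.map s t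
    rw [Category.comp_id, Category.assoc, ← comp_whiskerRight_assoc, natHom.id_π, precontact,
      ← whisker_exchange_assoc, eId_comp']
    simp)

/-- The source of `f` is the tensor product to which the hom-object of `X ⊗ T` unfolds. The lemma is
therefore applied as a term, up to definitional equality. -/
theorem sectionMap_π_assoc (a b : X) (s : T) {r : V} (f : (a ⟶[V] b) ⊗ (s ⟶[V] s) ⟶ r) :
    sectionMap m T a b ≫ natHom.π m (sectionObj m a) (sectionObj m b) s ≫ f =
      (ρ_ (a ⟶[V] b)).inv ≫ _ ◁ eId V s ≫ f :=
  (Category.assoc _ _ _).symm.trans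
    ((congrArg (· ≫ f) (sectionMap_π m T a b s)).trans (Category.assoc _ _ _))

/-- On objects this is preservation of units by `f`. On components both sides act by `f` on the
first factor and insert `1_s` in the second, and these operations commute by the exchange law for
whiskerings. -/
theorem sectionsFunctor_naturality (f : EnrichedFunctor V X X') :
    f.comp V (sectionsFunctor m X' T) =
      (sectionsFunctor m X T).comp V (Exponential.map m T (Biproduct.map m T f)) := by
  have h (a : X) := (sectionObj_comp_map m T f a).symm
  have key (a b : X) : (f.map a b ≫ sectionMap m T (f.obj a) (f.obj b)) ≫
      eqToHom (congrArg₂ (natHom m) (h a) (h b)) = sectionMap m T a b ≫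
        Exponential.mapHom m (Biproduct.map m T f) (sectionObj m a) (sectionObj m b) := by
    apply natHom.hom_ext
    intro s
    rw [Category.assoc, Category.assoc, Category.assoc, natHom.eqToHom_π m (h a) (h b),
      Exponential.mapHom_π]
    refine (congrArg (f.map a b ≫ ·) (sectionMap_π_assoc m T (f.obj a) (f.obj b) s _)).trans
      (Eq.trans ?_ (sectionMap_π_assoc m T a b s _).symm)
    -- At the component `s` both families of objects are `(f a, s)` by definition, so the `eqToHom`
    -- has become an identity.
    change f.map a b ≫ (ρ_ _).inv ≫ (f.obj a ⟶[V] f.obj b) ◁ eId V s ≫ 𝟙 _ =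
      (ρ_ _).inv ≫ (a ⟶[V] b) ◁ eId V s ≫ f.map a b ▷ (s ⟶[V] s)
    rw [whisker_exchange, Category.comp_id, rightUnitor_inv_naturality_assoc]
  exact EnrichedFunctor.ext V h key

/-- Evaluation is a component followed by a precontact arrow, and `f` commutes with precontact
because it preserves composition (`comp_precontact_target`). -/
theorem evaluationFunctor_naturality (f : EnrichedFunctor V Y Y') :
    (Biproduct.map m T (Exponential.map m T f)).comp V (evaluationFunctor m T Y') =
      (evaluationFunctor m T Y).comp V f :=
  EnrichedFunctor.ext V (fun _ => rfl) (fun p q => (Category.comp_id _).trans (by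
    have key (φ ψ : EnrichedFunctor V T Y) (s t : T) :
        Exponential.mapHom m f φ ψ ▷ (s ⟶[V] t) ≫
          natHom.π m (φ.comp V f) (ψ.comp V f) s ▷ (s ⟶[V] t) ≫
            precontact (φ.comp V f) (ψ.comp V f) s t =
        (natHom.π m φ ψ s ▷ (s ⟶[V] t) ≫ precontact φ ψ s t) ≫ f.map (φ.obj s) (ψ.obj t) := by
      rw [Category.assoc, ← comp_precontact_target, ← comp_whiskerRight_assoc,
        Exponential.mapHom_π]
      exact (congrArg (· ≫ _) (comp_whiskerRight _ _ _)).trans (Category.assoc _ _ _)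
    exact key p.1 q.1 p.2 q.2))

/-- The first triangular equality. On hom-objects it is exactly `precontact_section`, where the
middle unit axiom enters. -/
theorem map_sectionsFunctor_comp_evaluationFunctor (X : Type x) [EnrichedCategory V X] :
    (Biproduct.map m T (sectionsFunctor m X T)).comp V (evaluationFunctor m T (Biproduct m X T)) =
      EnrichedFunctor.id V (Biproduct m X T) :=
  EnrichedFunctor.ext V (fun _ => rfl) (fun p q => by
    obtain ⟨a, s⟩ := p
    obtain ⟨b, t⟩ := q
    change (sectionMap m T a b ▷ (s ⟶[V] t) ≫
        natHom.π m (sectionObj m a) (sectionObj m b) s ▷ (s ⟶[V] t) ≫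
          precontact (sectionObj m a) (sectionObj m b) s t) ≫ 𝟙 _ = 𝟙 _
    rw [Category.comp_id, ← comp_whiskerRight_assoc, sectionMap_π]
    exact precontact_section m T a b s t)

/-- The second triangular equality. The component at `s` sends `α` to the evaluation of `(α, 1_s)`,
that is, `α_s` followed by `ψ 1_s`; preservation of units by `ψ` and the right unit law of `Y`
return `α_s`. -/
theorem sectionsFunctor_comp_map_evaluationFunctor (Y : Type y) [EnrichedCategory V Y] :
    (sectionsFunctor m (Exponential m T Y) T).comp V
        (Exponential.map m T (evaluationFunctor m T Y)) =
      EnrichedFunctor.id V (Exponential m T Y) := by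
  have h (φ : EnrichedFunctor V T Y) := sectionObj_comp_evaluation m T φ
  have key (φ ψ : EnrichedFunctor V T Y) :
      (sectionMap (X := Exponential m T Y) m T φ ψ ≫ Exponential.mapHom m (evaluationFunctor m T Y)
        (sectionObj (X := Exponential m T Y) m φ) (sectionObj (X := Exponential m T Y) m ψ)) ≫
      eqToHom (congrArg₂ (natHom m) (h φ) (h ψ)) = 𝟙 (natHom m φ ψ) := by
    apply natHom.hom_ext
    intro s
    rw [Category.assoc, Category.assoc, natHom.eqToHom_π m (h φ) (h ψ),
      reassoc_of% (Exponential.mapHom_π m (evaluationFunctor m T Y)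
        (sectionObj (X := Exponential m T Y) m φ) (sectionObj (X := Exponential m T Y) m ψ) s)]
    refine (congrArg (sectionMap (X := Exponential m T Y) m T φ ψ ≫ ·)
      (Category.assoc _ _ _)).trans ?_
    refine (sectionMap_π_assoc (X := Exponential m T Y) m T φ ψ s _).trans ?_
    change (ρ_ (natHom m φ ψ)).inv ≫ natHom m φ ψ ◁ eId V s ≫
      (natHom.π m φ ψ s ▷ (s ⟶[V] s) ≫ precontact φ ψ s s) ≫ 𝟙 _ = 𝟙 _ ≫ natHom.π m φ ψ s
    rw [precontact, Category.comp_id, ← whisker_exchange_assoc,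
      ← MonoidalCategory.whiskerLeft_comp_assoc, ψ.map_id, whisker_exchange_assoc, comp_eId]
    simp
  exact EnrichedFunctor.ext V h key

end triangles

/-! ### Naturality of sections for transports of original `V`-graphs. -/

namespace OGrph
universe x y
variable {V : Type u} [Category.{v} V] [MonoidalCategory V]

/-- The counterpart of `EnrichedFunctor.ext` for transports: comparing edge maps through `eqToHom`
avoids the heterogeneous equality of structural extensionality. -/
theorem Transport.ext_eqToHom {X : OGrph.{x} V} {Y : OGrph.{y} V} {f g : Transport X Y}
    (h : ∀ a, f.obj a = g.obj a)
    (h' : ∀ a b, f.map a b ≫ eqToHom (congrArg₂ Y.edge (h a) (h b)) = g.map a b) : f = g := by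
  obtain ⟨fo, fm, hf⟩ := f
  obtain ⟨go, gm, hg⟩ := g
  obtain rfl : fo = go := funext h
  obtain rfl : fm = gm := by
    funext a b
    simpa using h' a b
  rfl

/-- Moves a cast between products of edge objects to a cast between their factors at `s`, where it
can reduce to an identity; compare `natHom.eqToHom_π`. -/
theorem exp_eqToHom_π [HasProducts.{w} V] {T : OGrph.{w} V} {Y : OGrph.{y} V}
    {φ φ' ψ ψ' : Transport T Y} (h₁ : φ = φ') (h₂ : ψ = ψ')
    (h : (exp T Y).edge φ ψ = (exp T Y).edge φ' ψ') (s : T.vertex) :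
    eqToHom h ≫ Pi.π (fun s : T.vertex => Y.edge (φ'.obj s) (ψ'.obj s)) s =
      Pi.π (fun s : T.vertex => Y.edge (φ.obj s) (ψ.obj s)) s ≫ eqToHom (by rw [h₁, h₂]) := by
  subst h₁ h₂; exact (Category.id_comp _).trans (Category.comp_id _).symm

theorem sectionObj_comp_tensorMap {X Y : OGrph.{x} V} (f : X ⟶ Y) (T : OGrph.{w} V)
    (a : X.vertex) :
    (sectionObj (T := T) a).comp (tensorMap f T) = sectionObj (f.obj a) :=
  Transport.ext_eqToHom (fun _ => rfl) (fun s t => by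
    change (((λ_ (T.edge s t)).inv ≫ X.unit a ▷ T.edge s t) ≫ f.map a a ▷ T.edge s t) ≫ 𝟙 _ =
      (λ_ (T.edge s t)).inv ≫ Y.unit (f.obj a) ▷ T.edge s t
    rw [Category.comp_id, Category.assoc, ← comp_whiskerRight, f.map_unit])

theorem sections_map_π [HasProducts.{w} V] (X : OGrph.{max w v c} V) (T : OGrph.{w} V)
    (a b : X.vertex) (s : T.vertex) :
    (sections.{c} X T).map a b ≫ Pi.π (fun s : T.vertex => X.edge a b ⊗ T.edge s s) s =
      (ρ_ (X.edge a b)).inv ≫ X.edge a b ◁ T.unit s :=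
  Pi.lift_π (fun s => (ρ_ (X.edge a b)).inv ≫ X.edge a b ◁ T.unit s) s

theorem expMap_map_π [HasProducts.{w} V] (T : OGrph.{w} V) {Y Z : OGrph.{y} V} (f : Y ⟶ Z)
    (φ ψ : Transport T Y) (s : T.vertex) :
    (expMap T f).map φ ψ ≫
        Pi.π (fun s : T.vertex => Z.edge (f.obj (φ.obj s)) (f.obj (ψ.obj s))) s =
      Pi.π (fun s : T.vertex => Y.edge (φ.obj s) (ψ.obj s)) s ≫ f.map (φ.obj s) (ψ.obj s) :=
  Pi.lift_π (fun s => Pi.π _ s ≫ f.map (φ.obj s) (ψ.obj s)) s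

/-- Sections are built from units and tensor products alone. Composition never enters, so
preservation of units and the exchange law for whiskerings suffice, as for `V`-functors. -/
theorem sections_naturality [HasProducts.{w} V] {X Y : OGrph.{max w v c} V} (f : X ⟶ Y)
    (T : OGrph.{w} V) :
    f ≫ sections.{c} Y T = sections.{c} X T ≫ expMap T (tensorMap f T) := by
  have h (a : X.vertex) := (sectionObj_comp_tensorMap f T a).symm
  refine Transport.ext_eqToHom h (fun a b => Pi.hom_ext _ _ (fun s => ?_))
  refine (Category.assoc _ _ _).trans ?_
  refine (congrArg (_ ≫ ·) (exp_eqToHom_π (h a) (h b) _ s)).trans ?_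
  have key : f.map a b ≫ (sections.{c} Y T).map (f.obj a) (f.obj b) ≫
        Pi.π (fun s : T.vertex => Y.edge (f.obj a) (f.obj b) ⊗ T.edge s s) s =
      (sections.{c} X T).map a b ≫
        Pi.π (fun s : T.vertex => X.edge a b ⊗ T.edge s s) s ≫ f.map a b ▷ T.edge s s := by
    refine Eq.trans ?_ ((congrArg (· ≫ f.map a b ▷ T.edge s s)
      (sections_map_π.{c} X T a b s)).symm.trans (Category.assoc _ _ _))
    rw [sections_map_π, Category.assoc, whisker_exchange, rightUnitor_inv_naturality_assoc]
  -- The cast now lies between edge objects that agree by definition, so it is removed as an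
  -- identity.
  refine (congrArg (_ ≫ ·) (Category.comp_id _)).trans ((Category.assoc _ _ _).trans ?_)
  refine key.trans (Eq.trans ?_ (Category.assoc _ _ _).symm)
  exact congrArg ((sections.{c} X T).map a b ≫ ·)
    (expMap_map_π T (tensorMap f T) (sectionObj a) (sectionObj b) s).symm

end OGrph

/-! ### The adjunction, its hom-set bijection, and comparison with original `V`-graphs. -/

namespace VCat
variable {V : Type u} [Category.{v} V] [MonoidalCategory V] [HasProducts.{w} V] [HasEqualizers V]
  [∀ s : V, (tensorRight s).IsLeftAdjoint] (m : RelatorInvolution V) (T : VCat.{w} V)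

/-- The adjunction between `- ⊗ T` and `(-) ^ (T)`, with unit the sections and counit the
evaluations. -/
noncomputable def tensorExpAdjunction : tensorFunctor.{c} m T ⊣ expFunctor.{c} m T where
  unit.app X := sections.{c} m T X
  unit.naturality _ _ f := sectionsFunctor_naturality m T.carrier f
  counit.app Y := ev.{c} m T Y
  counit.naturality _ _ f := evaluationFunctor_naturality m T.carrier f
  left_triangle_components X := map_sectionsFunctor_comp_evaluationFunctor m T.carrier X.carrier
  right_triangle_components Y := sectionsFunctor_comp_map_evaluationFunctor m T.carrier Y.carrier

/-- The definition of `name` is the general formula expressing the hom-set bijection through the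
unit. -/
theorem tensorExpAdjunction_homEquiv_apply {X Y : VCat.{max w v c} V}
    (f : (tensorFunctor.{c} m T).obj X ⟶ Y) :
    (tensorExpAdjunction.{c} m T).homEquiv X Y f = name.{c} m T f :=
  Adjunction.homEquiv_unit _ _ _ _

theorem tensorExpAdjunction_homEquiv_symm_apply {X Y : VCat.{max w v c} V}
    (g : X ⟶ (expFunctor.{c} m T).obj Y) :
    ((tensorExpAdjunction.{c} m T).homEquiv X Y).symm g = realization.{c} m T g :=
  Adjunction.homEquiv_counit _ _ _ _

/-- The two transports agree on vertices by definition. On edges, `natHom.ι` followed by a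
projection is by definition `natHom.π`, so the component formula of `sectionMap` is all that is
needed. -/
theorem sections_comp_expInclusion (X : VCat.{max w v c} V) :
    toOGrph.map (sections.{c} m T X) ≫ expInclusion.{c} m T _ =
      OGrph.sections.{c} X.graph T.graph := by
  refine OGrph.Transport.ext_eqToHom (fun _ => rfl)
    (fun a b => (Category.comp_id _).trans (Pi.hom_ext _ _ (fun s => ?_)))
  refine (Category.assoc _ _ _).trans ((sectionMap_π m T.carrier (X := X.carrier) a b s).trans ?_)
  exact (OGrph.sections_map_π.{c} X.graph T.graph a b s).symm

/-- Both changes of target apply `g` componentwise, so the two sides agree after each projection. -/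
theorem expFunctor_map_comp_expInclusion {Y Y' : VCat.{max w v c} V} (g : Y ⟶ Y') :
    toOGrph.map ((expFunctor.{c} m T).map g) ≫ expInclusion.{c} m T Y' =
      expInclusion.{c} m T Y ≫ OGrph.expMap T.graph (toOGrph.map g) := by
  refine OGrph.Transport.ext_eqToHom (fun _ => rfl)
    (fun φ ψ => (Category.comp_id _).trans (Pi.hom_ext _ _ (fun s => ?_)))
  refine (Category.assoc _ _ _).trans ((Exponential.mapHom_π m (T := T.carrier) (Y := Y.carrier)
    (Y' := Y'.carrier) g φ ψ s).trans ?_)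
  refine Eq.trans ?_ (Category.assoc _ _ _).symm
  refine Eq.trans ?_ (congrArg (natHom.ι (T := T.carrier) (Y := Y.carrier) m φ ψ ≫ ·)
    (OGrph.expMap_map_π T.graph (toOGrph.map g)
      (graphTransport (X := T) (Y := Y) φ) (graphTransport (X := T) (Y := Y) ψ) s).symm)
  exact Category.assoc _ _ _

end VCat

/-! ### The proposition. -/

/-- An object of `Y ^ (T)` is a `V`-functor and so contains arrows of `V`. Hence objects are taken
in `Type (max w v c)`, a size closed under both constructions, with `c` free. -/
theorem mainTheorem1 {V : Type u} [Category.{v} V] [MonoidalCategory V] [HasProducts.{w} V]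
    [HasEqualizers V] [∀ s : V, (tensorRight s).IsLeftAdjoint] (m : RelatorInvolution V)
    (T : VCat.{w} V) :
    (∃ adj : VCat.tensorFunctor.{c} m T ⊣ VCat.expFunctor.{c} m T,
      (∀ X, adj.unit.app X = VCat.sections.{c} m T X) ∧
      (∀ Y, adj.counit.app Y = VCat.ev.{c} m T Y) ∧
      (∀ X Y f, adj.homEquiv X Y f = VCat.name.{c} m T f) ∧
      (∀ X Y g, (adj.homEquiv X Y).symm g = VCat.realization.{c} m T g)) ∧
    (∀ (X Y : VCat.{max w v c} V) (f : (VCat.tensorFunctor.{c} m T).obj X ⟶ Y),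
      VCat.realization.{c} m T (VCat.name.{c} m T f) = f) ∧
    (∀ (X Y : VCat.{max w v c} V) (g : X ⟶ (VCat.expFunctor.{c} m T).obj Y),
      VCat.name.{c} m T (VCat.realization.{c} m T g) = g) ∧
    (∀ (X X' Y Y' : VCat.{max w v c} V) (h : X' ⟶ X) (k : Y ⟶ Y')
      (f : (VCat.tensorFunctor.{c} m T).obj X ⟶ Y),
      VCat.name.{c} m T ((VCat.tensorFunctor.{c} m T).map h ≫ f ≫ k) =
        h ≫ VCat.name.{c} m T f ≫ (VCat.expFunctor.{c} m T).map k) ∧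
    (∀ (X X' Y Y' : VCat.{max w v c} V) (h : X' ⟶ X) (k : Y ⟶ Y')
      (g : X ⟶ (VCat.expFunctor.{c} m T).obj Y),
      VCat.realization.{c} m T (h ≫ g ≫ (VCat.expFunctor.{c} m T).map k) =
        (VCat.tensorFunctor.{c} m T).map h ≫ VCat.realization.{c} m T g ≫ k) ∧
    (∀ X : VCat.{max w v c} V,
      (VCat.tensorFunctor.{c} m T).map (VCat.sections.{c} m T X) ≫
        VCat.ev.{c} m T ((VCat.tensorFunctor.{c} m T).obj X) = 𝟙 _) ∧
    (∀ Y : VCat.{max w v c} V,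
      VCat.sections.{c} m T ((VCat.expFunctor.{c} m T).obj Y) ≫
        (VCat.expFunctor.{c} m T).map (VCat.ev.{c} m T Y) = 𝟙 _) ∧
    (∀ (X Y : OGrph.{max w v c} V) (f : X ⟶ Y),
      f ≫ OGrph.sections.{c} Y T.graph =
        OGrph.sections.{c} X T.graph ≫
          OGrph.expMap T.graph (OGrph.tensorMap f T.graph)) ∧
    (∀ X : VCat.{max w v c} V,
      VCat.toOGrph.map (VCat.sections.{c} m T X) ≫ VCat.expInclusion.{c} m T _ =
        OGrph.sections.{c} X.graph T.graph) ∧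
    (∀ (Y Y' : VCat.{max w v c} V) (g : Y ⟶ Y'),
      VCat.toOGrph.map ((VCat.expFunctor.{c} m T).map g) ≫ VCat.expInclusion.{c} m T Y' =
        VCat.expInclusion.{c} m T Y ≫ OGrph.expMap T.graph (VCat.toOGrph.map g)) := by
  -- Rewriting names and realizations as the two directions of `homEquiv` turns the inverse and
  -- naturality claims into general facts about adjunctions.
  have hn {X Y} := @VCat.tensorExpAdjunction_homEquiv_apply.{c} V _ _ _ _ _ m T X Y
  have hr {X Y} := @VCat.tensorExpAdjunction_homEquiv_symm_apply.{c} V _ _ _ _ _ m T X Y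
  refine ⟨⟨VCat.tensorExpAdjunction.{c} m T, fun _ => rfl, fun _ => rfl, fun _ _ => hn,
    fun _ _ => hr⟩, fun X Y f => ?_, fun X Y g => ?_, fun X X' Y Y' h k f => ?_,
    fun X X' Y Y' h k g => ?_, (VCat.tensorExpAdjunction.{c} m T).left_triangle_components,
    (VCat.tensorExpAdjunction.{c} m T).right_triangle_components,
    fun X Y f => OGrph.sections_naturality.{c} f T.graph,
    VCat.sections_comp_expInclusion.{c} m T,
    fun _ _ => VCat.expFunctor_map_comp_expInclusion.{c} m T⟩
  · rw [← hn, ← hr, Equiv.symm_apply_apply]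
  · rw [← hn, ← hr, Equiv.apply_symm_apply]
  · rw [← hn, ← hn, Adjunction.homEquiv_naturality_left, Adjunction.homEquiv_naturality_right]
  · rw [← hr, ← hr, Adjunction.homEquiv_naturality_left_symm,
      Adjunction.homEquiv_naturality_right_symm]
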